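/- Let $n\ge 2$, and let $\mathfrak C_n=\{0,\dots,n-1\}^{\omega}$ be the boundary of the infinite rooted $n$-ary tree, whose nodes are the finite words over $\{0,\dots,n-1\}$. Finite $n$-ary trees are rooted at the empty word. A tree pair $(A,B,\sigma)$ consists of two finite $n$-ary trees and a bijection $\sigma$ from the leaves of $A$ to the leaves of $B$; it represents the homeomorphism of $\mathfrak C_n$ sending $\lambda z$ to $\sigma(\lambda)z$ for each leaf $\lambda$ of $A$ and each infinite word $z$. Let $V_n$ be the group of all homeomorphisms so represented. For $X\subseteq\mathfrak C_n$ let $(V_n)_X$ be the subgroup of those elements of $V_n$ that are the identity outside $X$. If $g\in V_n$ maps $uz$ to $vz$ for all $z$, where $u$ is a prefix of $r$, the slope of $g$ at $r$ is $rg'=(2n-1)^{|u|-|v|}$. Leaves of both $A$ and $B$ are called neutral. Each leaf $\gamma_0$ of $A$ that is not a leaf of $B$ starts a chain $\gamma_0,\gamma_1=\sigma(\gamma_0),\dots,\gamma_s$ with $\gamma_1,\dots,\gamma_{s-1}$ neutral and $\gamma_s$ a leaf of $B$ but not of $A$. The leaf $\gamma_0$ is a repeller if $\gamma_s$ is an ancestor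 of $\gamma_0$, and $\gamma_s$ is an attractor if $\gamma_0$ is an ancestor of $\gamma_s$. The components of $A-B$ are the subtrees of $A$ rooted at the leaves of $B$ that are interior nodes of $A$; those of $B-A$ are defined symmetrically. The pair is revealing if every component of $A-B$ contains a repeller and every component of $B-A$ contains an attractor. The leaves of $A-B$ that are not repellers are sources, and the leaves of $B-A$ that are not attractors are sinks. The vertices of the flow graph of a revealing pair are the repellers, the attractors and the neutral leaves that are periodic under $\sigma$. Each source whose chain ends in a sink gives an edge (flow line) from the repeller in the component of the source to the attractor in the component of the sink; in addition each periodic neutral leaf is joined to its image. A connected component of the flow graph is non-torsion if it contains a repeller or an attractor. Its support is then the closure of the union of the sets $\lambda\mathfrak C_n\,\alpha^k$, $k\in\mathbb Z$, over the sources $\lambda$ of its flow lines, where $\alpha$ is the represented element. Let $\alpha\in V_n$, let $(A,B,\sigma)$ be a revealing pair representing $\alpha$, let $\Gamma_i$ be a non-torsion component of its flow graph, and let $X_i$ be the support of $\Gamma_i$. Then there is a (necessarily unique) $\alpha_i\in (V_n)_{X_i}$ that agrees with $\alpha$ on $X_i$. Let $\mathcal R_{\alpha_i}$ be the set of repelling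 periodic points of $\alpha_i$, i.e. of all $r$ such that some power $\alpha_i^k$, $k\geq 1$, fixes $r$ and has slope $>1$ at $r$. This set is finite, and it consists of the points $\gamma_j\omega^\infty$, $0\le j<s$, where $\gamma_0\in\Gamma_i$ is a repeller with chain $\gamma_0,\dots,\gamma_s$ and $\gamma_0=\gamma_s\omega$. The formula $$\mathcal S_i(g)=\log_{2n-1}\Bigl(\prod_{r\in\mathcal R_{\alpha_i}} rg'\Bigr)$$ defines a group homomorphism $\mathcal S_i:C_{(V_n)_{X_i}}(\alpha_i)\to\mathbb Z$ on the centralizer of $\alpha_i$ in $(V_n)_{X_i}$. Its kernel $\ker(\mathcal S_i)$ is a finite group, $\ker(\mathcal S_i)$ is exactly the set of torsion elements of $C_{(V_n)_{X_i}}(\alpha_i)$, and $$C_{(V_n)_{X_i}}(\alpha_i)\cong \ker(\mathcal S_i)\rtimes\mathbb Z .$$ -/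

import Mathlib

namespace Thompson

/-! ### The Cantor set of infinite words and its nodes -/

/-- The Cantor set of infinite descending paths in the rooted `n`-ary tree, with the product
topology. The nodes of the tree are the finite words, of type `List (Fin n)`; `u <+: v` says that
`u` is `v` or an ancestor of `v`. -/
abbrev Cantor (n : ℕ) : Type := ℕ → Fin n

/-- The infinite path that first follows `w` and then `z`. -/
def cat {n : ℕ} (w : List (Fin n)) (z : Cantor n) : Cantor n :=
  fun k => w.getD k (z (k - w.length))

/-- The Cantor set under the node `w`. -/
def cone {n : ℕ} (w : List (Fin n)) : Set (Cantor n) := Set.range (cat w)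

/-- A finite rooted `n`-ary tree, given by its set of nodes: every node has either no child in the
tree or all of its `n` children. -/
structure NTree (n : ℕ) where
  nodes : Set (List (Fin n))
  finite : nodes.Finite
  root_mem : [] ∈ nodes
  parent_mem : ∀ w i, w ++ [i] ∈ nodes → w ∈ nodes
  sibling_mem : ∀ w i j, w ++ [i] ∈ nodes → w ++ [j] ∈ nodes

/-- The leaves of a tree. -/
def NTree.leaves {n : ℕ} (T : NTree n) : Set (List (Fin n)) :=
  {w | w ∈ T.nodes ∧ ∀ i, w ++ [i] ∉ T.nodes}

/-- A tree pair `(A, B, σ)`, where `σ` is a bijection from the leaves of the domain tree `A` to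
the leaves of the range tree `B`. -/
structure TreePair (n : ℕ) where
  A : NTree n
  B : NTree n
  σ : A.leaves ≃ B.leaves

/-- The homeomorphism `g` is the one that the tree pair `P` describes: it carries the interval
under each leaf of `A` to the interval under the corresponding leaf of `B` by exchanging the
prefix (the orientation preserving affine bijection). -/
def TreePair.Represents {n : ℕ} (P : TreePair n) (g : Cantor n ≃ₜ Cantor n) : Prop :=
  ∀ (a : P.A.leaves) (z : Cantor n), g (cat (a : List (Fin n)) z) = cat (P.σ a : List (Fin n)) z

/-! ### Facts used to see that the representable homeomorphisms form a group -/

/-- The first `k` letters of an infinite word. -/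
def pre {n : ℕ} (x : Cantor n) (k : ℕ) : List (Fin n) := List.ofFn (fun i : Fin k => x i)

theorem length_pre {n : ℕ} (x : Cantor n) (k : ℕ) : (pre x k).length = k := by simp [pre]

theorem pre_succ {n : ℕ} (x : Cantor n) (k : ℕ) : pre x (k + 1) = pre x k ++ [x k] := by
  simp only [pre]
  rw [List.ofFn_succ']
  simp [List.concat_eq_append]

theorem cat_nil {n : ℕ} (z : Cantor n) : cat [] z = z := by
  funext k; simp [cat]

theorem cat_append {n : ℕ} (u v : List (Fin n)) (z : Cantor n) :
    cat (u ++ v) z = cat u (cat v z) := by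
  funext k
  simp only [cat, List.getD_eq_getElem?_getD, List.length_append]
  by_cases h : k < u.length
  · simp [List.getElem?_append_left h, h]
  · push Not at h
    rw [List.getElem?_append_right h, List.getElem?_eq_none h]
    simp [Nat.sub_sub]

theorem cat_injective {n : ℕ} (w : List (Fin n)) : Function.Injective (cat w) := by
  intro z z' h
  funext k
  have := congrFun h (w.length + k)
  simpa [cat] using this

theorem cat_pre {n : ℕ} (x : Cantor n) (k : ℕ) : cat (pre x k) (fun i => x (k + i)) = x := by
  funext i
  by_cases h : i < k
  · simp [cat, pre, h]
  · push Not at h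
    simp [cat, pre, h]

theorem pre_cat {n : ℕ} (w : List (Fin n)) (z : Cantor n) : pre (cat w z) w.length = w := by
  apply List.ext_getElem (by simp [pre])
  intro i h1 h2
  simp [pre, cat]

theorem eq_of_cat_eq {n : ℕ} {u v : List (Fin n)} {z z' : Cantor n} (h : cat u z = cat v z')
    (hl : u.length = v.length) : u = v := by
  rw [← pre_cat u z, ← pre_cat v z', h, hl]

theorem prefix_of_cat_eq {n : ℕ} {u v : List (Fin n)} {z z' : Cantor n} (h : cat u z = cat v z')
    (hl : u.length ≤ v.length) : u <+: v := by
  refine ⟨v.drop u.length, ?_⟩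
  have h2 : cat v z' = cat (v.take u.length) (cat (v.drop u.length) z') := by
    rw [← cat_append, List.take_append_drop]
  have h3 : u = v.take u.length := eq_of_cat_eq (h.trans h2) (by simp [hl])
  conv_lhs => rw [h3]
  simp [hl]

/-- Near every point the map exchanges one finite prefix for another. -/
def IsLocal {n : ℕ} (g : Cantor n ≃ₜ Cantor n) : Prop :=
  ∀ x, ∃ u v : List (Fin n), x ∈ cone u ∧ ∀ z, g (cat u z) = cat v z

theorem NTree.exists_leaf {n : ℕ} (T : NTree n) (x : Cantor n) : ∃ w ∈ T.leaves, x ∈ cone w := by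
  classical
  have hex : ∃ k, pre x k ∉ T.nodes := by
    by_contra! hc
    have : Set.InjOn (pre x) Set.univ := by
      intro a _ b _ hab
      have := congrArg List.length hab
      simpa [length_pre] using this
    exact (Set.infinite_univ.image this) (T.finite.subset (by rintro _ ⟨k, -, rfl⟩; exact hc k))
  obtain ⟨m, hm⟩ : ∃ m, Nat.find hex = m + 1 := by
    rcases h0 : Nat.find hex with _ | m
    · have := Nat.find_spec hex
      rw [h0] at this
      exact absurd T.root_mem (by simpa [pre] using this)
    · exact ⟨m, rfl⟩
  have h1 : pre x m ∈ T.nodes := by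
    by_contra hc
    have := Nat.find_min' hex hc
    omega
  refine ⟨pre x m, ⟨h1, fun i hi => ?_⟩, ⟨_, cat_pre x m⟩⟩
  have h2 := Nat.find_spec hex
  rw [hm, pre_succ] at h2
  exact h2 (T.sibling_mem _ _ _ hi)

theorem TreePair.isLocal {n : ℕ} {P : TreePair n} {g : Cantor n ≃ₜ Cantor n}
    (h : P.Represents g) : IsLocal g := by
  intro x
  obtain ⟨w, hw, hx⟩ := P.A.exists_leaf x
  exact ⟨w, P.σ ⟨w, hw⟩, hx, fun z => h ⟨w, hw⟩ z⟩

theorem IsLocal.one {n : ℕ} : IsLocal (1 : Cantor n ≃ₜ Cantor n) := fun x =>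
  ⟨[], [], ⟨x, cat_nil x⟩, fun _ => rfl⟩

theorem IsLocal.mul {n : ℕ} {g f : Cantor n ≃ₜ Cantor n} (hg : IsLocal g) (hf : IsLocal f) :
    IsLocal (g * f) := by
  intro x
  obtain ⟨u, v, ⟨z, rfl⟩, hfu⟩ := hf x
  obtain ⟨u', v', ⟨z', hz'⟩, hgu⟩ := hg (cat v z)
  rcases le_total v.length u'.length with hl | hl
  · obtain ⟨t, rfl⟩ := prefix_of_cat_eq hz'.symm hl
    rw [cat_append] at hz'
    have hz := cat_injective v hz'
    refine ⟨u ++ t, v', ⟨z', by rw [cat_append, hz]⟩, fun y => ?_⟩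
    change g (f _) = _
    rw [cat_append, hfu, ← cat_append, hgu]
  · obtain ⟨t, rfl⟩ := prefix_of_cat_eq hz' hl
    refine ⟨u, v' ++ t, ⟨z, rfl⟩, fun y => ?_⟩
    change g (f _) = _
    rw [hfu, cat_append, hgu, cat_append]

theorem IsLocal.inv {n : ℕ} {g : Cantor n ≃ₜ Cantor n} (hg : IsLocal g) : IsLocal g⁻¹ := by
  intro y
  obtain ⟨u, v, ⟨z, hz⟩, h⟩ := hg (g.symm y)
  refine ⟨v, u, ⟨z, ?_⟩, fun z => ?_⟩
  · rw [← h z, hz]; simp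
  · change g.symm _ = _
    rw [← h z]; simp

theorem IsLocal.exists_uniform {n : ℕ} {g : Cantor n ≃ₜ Cantor n} (hg : IsLocal g) :
    ∃ N : ℕ, ∀ x : Cantor n, ∃ v : List (Fin n), ∀ z, g (cat (pre x N) z) = cat v z := by
  choose u v hu huv using hg
  have hU : ∀ x : Cantor n, {y : Cantor n | ∀ k < (u x).length, y k = x k} ∈ nhds x := by
    intro x
    have := set_pi_mem_nhds (x := x) (s := fun i => {x i}) (Set.finite_Iio (u x).length)
      (fun i _ => (isOpen_discrete _).mem_nhds rfl)
    filter_upwards [this] with y hy k hk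
    exact hy k hk
  obtain ⟨t, ht⟩ := CompactSpace.elim_nhds_subcover _ hU
  refine ⟨t.sup (fun x => (u x).length), fun x => ?_⟩
  have hx : x ∈ ⋃ y ∈ t, {y' : Cantor n | ∀ k < (u y).length, y' k = y k} := by
    rw [ht]; trivial
  simp only [Set.mem_iUnion] at hx
  obtain ⟨y, hyt, hxy⟩ := hx
  have hle : (u y).length ≤ t.sup (fun x => (u x).length) :=
    Finset.le_sup (f := fun x => (u x).length) hyt
  obtain ⟨z, hz⟩ := hu y
  have h1 : u y = pre x (u y).length := by
    conv_lhs => rw [← pre_cat (u y) z, hz]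
    apply List.ext_getElem (by simp [pre])
    intro i h1 h2
    rw [length_pre] at h1
    simpa [pre] using (hxy i h1).symm
  have h2 : u y <+: pre x (t.sup (fun x => (u x).length)) := by
    refine prefix_of_cat_eq (z := fun i => x ((u y).length + i)) ?_ (by rw [length_pre]; exact hle)
      (z' := fun i => x (t.sup (fun x => (u x).length) + i))
    rw [cat_pre]
    conv_lhs => rw [h1]
    simp only [length_pre]
    exact cat_pre x _
  obtain ⟨s, hs⟩ := h2
  refine ⟨v y ++ s, fun z => ?_⟩
  rw [← hs, cat_append, huv, cat_append]

theorem IsLocal.exists_treePair {n : ℕ} {g : Cantor n ≃ₜ Cantor n} (hg : IsLocal g) :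
    ∃ P : TreePair n, P.Represents g := by
  classical
  rcases Nat.eq_zero_or_pos n with rfl | hn
  · let T : NTree 0 := ⟨{[]}, Set.finite_singleton _, rfl, fun _ i => i.elim0, fun _ i => i.elim0⟩
    exact ⟨⟨T, T, Equiv.refl _⟩, fun _ z => (z 0).elim0⟩
  obtain ⟨N, hN⟩ := hg.exists_uniform
  let z0 : Cantor n := fun _ => ⟨0, hn⟩
  have hN' : ∀ w : List (Fin n), ∃ v : List (Fin n), w.length = N → ∀ z, g (cat w z) = cat v z := by
    intro w
    obtain ⟨v, hv⟩ := hN (cat w z0)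
    refine ⟨v, fun hw z => ?_⟩
    rw [← hw, pre_cat] at hv
    exact hv z
  choose V hV using hN'
  have hpc : ∀ w w', w.length = N → w'.length = N → V w <+: V w' → w = w' := by
    rintro w w' hw hw' ⟨t, ht⟩
    have h1 : g (cat w' z0) = g (cat w (cat t z0)) := by
      rw [hV w' hw', hV w hw, ← cat_append, ht]
    exact (eq_of_cat_eq (g.injective h1) (hw'.trans hw.symm)).symm
  let A : NTree n :=
    { nodes := {w | w.length ≤ N}
      finite := List.finite_length_le _ _
      root_mem := by simp
      parent_mem := by
        intro w i h
        simp only [Set.mem_ofPred_eq, List.length_append, List.length_singleton] at h ⊢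
        omega
      sibling_mem := by
        intro w i j h
        simpa using h }
  have hA : ∀ w, w ∈ A.leaves ↔ w.length = N := by
    intro w
    simp only [NTree.leaves, A, Set.mem_ofPred_eq, List.length_append, List.length_singleton]
    constructor
    · rintro ⟨h1, h2⟩
      have := h2 ⟨0, hn⟩
      omega
    · intro h
      exact ⟨h.le, fun _ => by omega⟩
  have hfin : {b : List (Fin n) | ∃ w, w.length = N ∧ b <+: V w}.Finite := by
    have : {b : List (Fin n) | ∃ w, w.length = N ∧ b <+: V w} =
        ⋃ w ∈ {w : List (Fin n) | w.length = N}, {b | b ∈ (V w).inits} := by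
      ext b; simp
    rw [this]
    exact (List.finite_length_eq _ _).biUnion (fun w _ => List.finite_toSet _)
  let B : NTree n :=
    { nodes := {b | ∃ w, w.length = N ∧ b <+: V w}
      finite := hfin
      root_mem := ⟨pre z0 N, length_pre _ _, List.nil_prefix⟩
      parent_mem := by
        rintro b i ⟨w, hw, h⟩
        exact ⟨w, hw, (List.prefix_append _ _).trans h⟩
      sibling_mem := by
        rintro b i j ⟨w, hw, h⟩
        obtain ⟨y, hy⟩ := g.surjective (cat (b ++ [j]) z0)
        refine ⟨pre y N, length_pre _ _, ?_⟩
        rw [← cat_pre y N, hV _ (length_pre _ _)] at hy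
        rcases le_total (b ++ [j]).length (V (pre y N)).length with hl | hl
        · exact prefix_of_cat_eq hy.symm hl
        · have h3 := prefix_of_cat_eq hy hl
          rcases List.prefix_concat_iff.1 h3 with h4 | h4
          · rw [h4]
          · exfalso
            have h5 : V (pre y N) <+: V w := h4.trans ((List.prefix_append _ _).trans h)
            have h6 := hpc _ _ (length_pre _ _) hw h5
            rw [h6] at h4
            have h7 := h.length_le
            have h8 := h4.length_le
            simp at h7
            omega }
  have hB : ∀ w, w.length = N → V w ∈ B.leaves := by
    intro w hw
    refine ⟨⟨w, hw, List.prefix_rfl⟩, ?_⟩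
    rintro i ⟨w', hw', h⟩
    have h1 := hpc w w' hw hw' ((List.prefix_append _ _).trans h)
    subst h1
    have := h.length_le
    simp at this
  refine ⟨⟨A, B, Equiv.ofBijective (fun a : A.leaves => ⟨V a, hB a ((hA _).1 a.2)⟩) ⟨?_, ?_⟩⟩, ?_⟩
  · intro a a' h
    have h1 : V a = V a' := congrArg Subtype.val h
    exact Subtype.ext (hpc _ _ ((hA _).1 a.2) ((hA _).1 a'.2) (h1 ▸ List.prefix_rfl))
  · rintro ⟨b, ⟨w, hw, t, ht⟩, hb⟩
    refine ⟨⟨w, (hA _).2 hw⟩, Subtype.ext ?_⟩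
    change V w = b
    rcases t with _ | ⟨i, t⟩
    · simpa using ht.symm
    · exact absurd ⟨w, hw, t, by simpa using ht⟩ (hb i)
  · intro a z
    exact hV _ ((hA _).1 a.2) z

/-! ### The group `V_n`, supports and slopes -/

/-- The Higman-Thompson group `V_n` of all homeomorphisms represented by a tree pair. -/
def V (n : ℕ) : Subgroup (Cantor n ≃ₜ Cantor n) where
  carrier := {g | ∃ P : TreePair n, P.Represents g}
  mul_mem' := by
    rintro g f ⟨P, hP⟩ ⟨Q, hQ⟩
    exact ((TreePair.isLocal hP).mul (TreePair.isLocal hQ)).exists_treePair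
  one_mem' := IsLocal.one.exists_treePair
  inv_mem' := by
    rintro g ⟨P, hP⟩
    exact (TreePair.isLocal hP).inv.exists_treePair

/-- `G_X`: the subgroup of those elements of `G` that are the identity outside `X`. -/
def restrictedTo {n : ℕ} (G : Subgroup (Cantor n ≃ₜ Cantor n)) (X : Set (Cantor n)) :
    Subgroup (Cantor n ≃ₜ Cantor n) where
  carrier := {g | g ∈ G ∧ ∀ x, x ∉ X → g x = x}
  mul_mem' := by
    rintro g f ⟨hg, hg'⟩ ⟨hf, hf'⟩
    refine ⟨G.mul_mem hg hf, fun x hx => ?_⟩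
    change g (f x) = x
    rw [hf' x hx, hg' x hx]
  one_mem' := ⟨G.one_mem, fun _ _ => rfl⟩
  inv_mem' := by
    rintro g ⟨hg, hg'⟩
    refine ⟨G.inv_mem hg, fun x hx => ?_⟩
    change g.symm x = x
    rw [Homeomorph.symm_apply_eq, hg' x hx]

/-- `g` is affine near `r` with slope `m`. The interval of the Cantor set in `[0, 1]` under a node
`w` has length `(2 n - 1) ^ (- |w|)`, so the affine bijection from the interval under `u` to the
interval under `v` has slope `(2 n - 1) ^ (|u| - |v|)`. -/
def HasSlopeAt {n : ℕ} (g : Cantor n ≃ₜ Cantor n) (r : Cantor n) (m : ℝ) : Prop :=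
  ∃ u v : List (Fin n), r ∈ cone u ∧ (∀ z, g (cat u z) = cat v z) ∧
    m = (2 * (n : ℝ) - 1) ^ ((u.length : ℤ) - (v.length : ℤ))

open Classical in
/-- The slope of `g` at `r`. For `n ≥ 2` and `g` in `V_n` there is exactly one. -/
noncomputable def slope {n : ℕ} (g : Cantor n ≃ₜ Cantor n) (r : Cantor n) : ℝ :=
  if h : ∃ m, HasSlopeAt g r m then h.choose else 1

/-- The repelling periodic points of `g`: the fixed points of some positive power of `g` at which
that power has slope larger than one. -/
def repellingPoints {n : ℕ} (g : Cantor n ≃ₜ Cantor n) : Set (Cantor n) :=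
  {r | ∃ k : ℕ, 0 < k ∧ (g ^ k) r = r ∧ 1 < slope (g ^ k) r}

/-- The logarithm to the base `2 n - 1` of the product of the slopes of `g` at the points
of `R`. -/
noncomputable def logSlopeProduct {n : ℕ} (R : Set (Cantor n)) (g : Cantor n ≃ₜ Cantor n) : ℝ :=
  Real.logb (2 * (n : ℝ) - 1) (∏ᶠ r ∈ R, slope g r)

/-! ### Revealing pairs -/

namespace TreePair

variable {n : ℕ}

/-- `σ` takes the leaf `a` of `A` to the leaf `b` of `B`. -/
def Maps (P : TreePair n) (a b : List (Fin n)) : Prop :=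
  ∃ h : a ∈ P.A.leaves, (P.σ ⟨a, h⟩ : List (Fin n)) = b

/-- `γ 0, …, γ s` is the iterated augmentation chain of a non-periodic leaf: it starts at a leaf of
`A` that is not a leaf of `B`, each term is taken to the next one, and it ends at the first leaf of
`B` that is not a leaf of `A`. (So `γ i` is a neutral leaf for `0 < i < s`.) -/
def IsChain (P : TreePair n) (γ : ℕ → List (Fin n)) (s : ℕ) : Prop :=
  γ 0 ∈ P.A.leaves ∧ γ 0 ∉ P.B.leaves ∧ (∀ i < s, P.Maps (γ i) (γ (i + 1))) ∧
    γ s ∈ P.B.leaves ∧ γ s ∉ P.A.leaves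

/-- A leaf `a` of `A` is a repeller if its chain ends at an ancestor of `a`. -/
def IsRepeller (P : TreePair n) (a : List (Fin n)) : Prop :=
  ∃ γ s, P.IsChain γ s ∧ γ 0 = a ∧ γ s <+: a

/-- A leaf `b` of `B` is an attractor if the chain that ends at `b` starts at an ancestor
of `b`. -/
def IsAttractor (P : TreePair n) (b : List (Fin n)) : Prop :=
  ∃ γ s, P.IsChain γ s ∧ γ s = b ∧ γ 0 <+: b

/-- The roots of the components of `A - B`: the leaves of `B` that are interior nodes of `A`. -/
def domRoots (P : TreePair n) : Set (List (Fin n)) :=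
  {ρ | ρ ∈ P.B.leaves ∧ ρ ∈ P.A.nodes ∧ ρ ∉ P.A.leaves}

/-- The roots of the components of `B - A`: the leaves of `A` that are interior nodes of `B`. -/
def ranRoots (P : TreePair n) : Set (List (Fin n)) :=
  {ρ | ρ ∈ P.A.leaves ∧ ρ ∈ P.B.nodes ∧ ρ ∉ P.B.leaves}

/-- Every component of `A - B` contains a repeller and every component of `B - A` contains an
attractor. -/
def IsRevealing (P : TreePair n) : Prop :=
  (∀ ρ ∈ P.domRoots, ∃ a, P.IsRepeller a ∧ ρ <+: a) ∧
    (∀ ρ ∈ P.ranRoots, ∃ b, P.IsAttractor b ∧ ρ <+: b)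

/-- A source is a leaf of `A - B` that is not a repeller. -/
def IsSource (P : TreePair n) (a : List (Fin n)) : Prop :=
  a ∈ P.A.leaves ∧ (∃ ρ ∈ P.domRoots, ρ <+: a) ∧ ¬ P.IsRepeller a

/-- A sink is a leaf of `B - A` that is not an attractor. -/
def IsSink (P : TreePair n) (b : List (Fin n)) : Prop :=
  b ∈ P.B.leaves ∧ (∃ ρ ∈ P.ranRoots, ρ <+: b) ∧ ¬ P.IsAttractor b

/-- A periodic neutral leaf: iterating `σ` through leaves leads back to it. -/
def IsPeriodicLeaf (P : TreePair n) (a : List (Fin n)) : Prop :=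
  Relation.TransGen P.Maps a a

/-! ### The flow graph -/

/-- The vertices of the flow graph: the repellers, the attractors and the periodic neutral
leaves. -/
def FlowVertex (P : TreePair n) : Type :=
  {a : List (Fin n) // P.IsRepeller a ∨ P.IsAttractor a ∨ P.IsPeriodicLeaf a}

/-- The source `c` gives a flow line from the repeller `a` to the attractor `b`: it lies in the
component of `A - B` of `a`, and its chain ends at a sink in the component of `B - A` of `b`. -/
def IsFlowLine (P : TreePair n) (a b c : List (Fin n)) : Prop :=
  P.IsRepeller a ∧ P.IsAttractor b ∧ P.IsSource c ∧ (∃ ρ ∈ P.domRoots, ρ <+: a ∧ ρ <+: c) ∧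
    ∃ γ s, P.IsChain γ s ∧ γ 0 = c ∧ P.IsSink (γ s) ∧ ∃ ρ ∈ P.ranRoots, ρ <+: b ∧ ρ <+: γ s

/-- The directed edges of the flow graph between distinct vertices. -/
def FlowEdge (P : TreePair n) (u v : P.FlowVertex) : Prop :=
  (∃ c, P.IsFlowLine u.1 v.1 c) ∨
    (P.IsPeriodicLeaf u.1 ∧ P.IsPeriodicLeaf v.1 ∧ P.Maps u.1 v.1)

/-- The flow graph, seen as an undirected graph without loops and multiple edges; this has the same
connected components. -/
def flowGraph (P : TreePair n) : SimpleGraph P.FlowVertex := SimpleGraph.fromRel P.FlowEdge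

/-- A component is non-torsion if it does not come from periodic neutral leaves. -/
def IsNonTorsion (P : TreePair n) (Γ : P.flowGraph.ConnectedComponent) : Prop :=
  ∃ v ∈ Γ.supp, P.IsRepeller v.1 ∨ P.IsAttractor v.1

/-- The underlying set of a non-torsion component of the flow graph of a pair representing `α`: the
closure of the union of the bi-infinite orbits, under `α`, of the intervals under the sources of
its flow lines. -/
def support (P : TreePair n) (α : Cantor n ≃ₜ Cantor n) (Γ : P.flowGraph.ConnectedComponent) :
    Set (Cantor n) :=
  closure {x | ∃ u ∈ Γ.supp, ∃ v ∈ Γ.supp, ∃ c, P.IsFlowLine u.1 v.1 c ∧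
    ∃ k : ℤ, x ∈ (α ^ k) '' cone c}

/-- The points that label the repelling periodic orbits of a component: for each repeller `γ 0` of
the component, with chain `γ 0, …, γ s` and spine `w` (so that `γ 0 = γ s w`), the points
`γ i w w w …` with `0 ≤ i < s`. The infinite word `q = w w w …` is the solution of `q = w q`. -/
def repellingLabels (P : TreePair n) (Γ : P.flowGraph.ConnectedComponent) : Set (Cantor n) :=
  {p | ∃ u ∈ Γ.supp, ∃ γ s w q, P.IsChain γ s ∧ γ 0 = u.1 ∧ γ 0 = γ s ++ w ∧ cat w q = q ∧
    ∃ i < s, p = cat (γ i) q}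

end TreePair

end Thompson

open Thompson

/-!
A repeller or attractor `v` lies in a component of `A - B` or `B - A` with root `ρ`, say `v = ρ ω`.
The chain of `v` says that a power of `α` (negative for a repeller, positive for an attractor) sends
`ρ z` to `ρ ω z` (`TreePair.IsRoot.exists_spine`). So the cone of `ρ` contracts to one periodic
point `ρ ω ω ω …`, and everything in the cone except that point has an iterate outside the cone of
`v`, in the cone of a source or a sink of the component. In a revealing pair each source has a chain
to a sink, so the orbits of the sources of `Γ` fill these cones up to the periodic points. It
follows that the support `X` is the union of the cones of the finitely many nodes on the chains of
`Γ` (`TreePair.support_eq_chainCones`). Hence `X` is clopen, `α_Γ` exists, each point of `X` has an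
iterate in the cone of some root, and the repelling points are those at the ends of the spines of
the repellers.

The logarithm of the slope is an integral cocycle, by the chain rule, and an element `g` of the
centralizer permutes the finite set `R` of repelling points. The key fact is rigidity
(`TreePair.support_subset_of_repellingLabel_mem`): if `g` is the identity near a point of `R`, then
`g = 1`. The interior `F` of the fixed set of `g` is invariant under `α_Γ`; if it contains the
periodic point of a root it contains the cone of that root, hence the cones of the sources there and
of the sinks to which flow lines carry them. The iterates of such a sink under `α` accumulate at the
periodic point of the attractor, and as an element of `V n` whose slope at a fixed point is not one
has no other fixed points nearby, that periodic point is in `F` as well. The same works backwards,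
so `F` contains the cones of all roots of the connected graph `Γ`, and then all of `X`.

The rest is group theory (`exists_hom_of_cocycle`). An element of the centralizer is determined by
the image of one `r ∈ R` and the slope at `r`; in particular the stabilizer of `r` embeds in `ℤ` by
the slope. It contains a power of `α_Γ` whose slopes on `R` all exceed one, so the kernel of `S`
meets the stabilizer trivially and `g ↦ g r` embeds the kernel in `R`. The image of `S` is infinite
cyclic, so the extension splits.
-/

namespace Thompson

/-! ### Cones and periodic words -/

section Words

variable {n : ℕ}

theorem cat_mem_cone (w : List (Fin n)) (z : Cantor n) : cat w z ∈ cone w := ⟨z, rfl⟩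

theorem cone_subset_of_prefix {u v : List (Fin n)} (h : u <+: v) : cone v ⊆ cone u := by
  obtain ⟨t, rfl⟩ := h
  rintro _ ⟨z, rfl⟩
  exact ⟨cat t z, (cat_append _ _ _).symm⟩

theorem prefix_or_prefix_of_mem_cone {u v : List (Fin n)} {x : Cantor n} (hu : x ∈ cone u)
    (hv : x ∈ cone v) : u <+: v ∨ v <+: u := by
  obtain ⟨z, rfl⟩ := hu
  obtain ⟨z', h⟩ := hv
  exact (le_total u.length v.length).imp (prefix_of_cat_eq h.symm) (prefix_of_cat_eq h)

theorem mem_cone_pre (x : Cantor n) (k : ℕ) : x ∈ cone (pre x k) := ⟨_, cat_pre x k⟩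

theorem mem_cone_iff {w : List (Fin n)} {x : Cantor n} : x ∈ cone w ↔ pre x w.length = w := by
  constructor
  · rintro ⟨z, rfl⟩
    exact pre_cat w z
  · intro h
    rw [← h]
    exact mem_cone_pre _ _

theorem pre_eq_pre_iff {x y : Cantor n} {k : ℕ} : pre x k = pre y k ↔ ∀ i < k, x i = y i := by
  simp only [pre, List.ofFn_inj, funext_iff]
  exact ⟨fun h i hi => h ⟨i, hi⟩, fun h i => h i i.2⟩

theorem continuous_cat (w : List (Fin n)) : Continuous (cat w) := by
  refine continuous_pi fun k => ?_
  by_cases h : k < w.length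
  · simpa [cat, h] using continuous_const
  · simpa [cat, h] using continuous_apply _

theorem isClosed_cone (w : List (Fin n)) : IsClosed (cone w) :=
  (isCompact_range (continuous_cat w)).isClosed

theorem cone_pre_mem_nhds (x : Cantor n) (k : ℕ) : cone (pre x k) ∈ nhds x := by
  have := set_pi_mem_nhds (x := x) (s := fun i => {x i}) (Set.finite_Iio k)
    (fun i _ => (isOpen_discrete _).mem_nhds rfl)
  filter_upwards [this] with y hy
  rw [mem_cone_iff, length_pre, pre_eq_pre_iff]
  exact fun i hi => hy i hi

theorem isOpen_cone (w : List (Fin n)) : IsOpen (cone w) := by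
  rw [isOpen_iff_mem_nhds]
  intro x hx
  have := cone_pre_mem_nhds x w.length
  rwa [mem_cone_iff.1 hx] at this

/-- The cones form a neighbourhood basis. -/
theorem exists_cone_pre_subset {x : Cantor n} {U : Set (Cantor n)} (hU : U ∈ nhds x) :
    ∃ k, ∀ m, k ≤ m → cone (pre x m) ⊆ U := by
  rw [nhds_pi, Filter.mem_pi] at hU
  obtain ⟨I, hI, t, ht, htU⟩ := hU
  obtain ⟨k, hk⟩ := hI.bddAbove
  refine ⟨k + 1, fun m hm y hy => htU fun i hi => ?_⟩
  rw [mem_cone_iff, length_pre, pre_eq_pre_iff] at hy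
  rw [hy i (by have := hk hi; omega)]
  exact mem_of_mem_nhds (ht i)

theorem iterate_cat_apply_eq {w : List (Fin n)} (hw : w ≠ []) (y z : Cantor n) (k : ℕ) :
    ∀ i < k, (cat w)^[k] y i = (cat w)^[k] z i := by
  induction k with
  | zero => intro i hi; omega
  | succ k ih =>
    intro i hi
    rw [Function.iterate_succ_apply', Function.iterate_succ_apply']
    have := List.length_pos_of_ne_nil hw
    by_cases h : i < w.length
    · simp [cat, h]
    · simpa [cat, h] using ih (i - w.length) (by omega)

/-- The map that prepends a nonempty word is a contraction, with a unique periodic point. -/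
theorem eq_of_iterate_cat_eq {w : List (Fin n)} (hw : w ≠ []) {q z : Cantor n} {m : ℕ}
    (hm : 0 < m) (hq : cat w q = q) (hz : (cat w)^[m] z = z) : z = q := by
  funext i
  have h1 : (cat w)^[m * (i + 1)] z = z := by
    rw [Function.iterate_mul]
    exact Function.iterate_fixed hz _
  have h2 : (cat w)^[m * (i + 1)] q = q := Function.iterate_fixed hq _
  have := iterate_cat_apply_eq hw z q (m * (i + 1)) i (by nlinarith)
  rwa [h1, h2] at this

theorem eq_of_cat_self {w : List (Fin n)} (hw : w ≠ []) {q z : Cantor n}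
    (hq : cat w q = q) (hz : cat w z = z) : z = q :=
  eq_of_iterate_cat_eq hw one_pos hq hz

theorem exists_cat_self {w : List (Fin n)} (hw : w ≠ []) : ∃ q : Cantor n, cat w q = q := by
  have hl := List.length_pos_of_ne_nil hw
  refine ⟨fun k => w[k % w.length]'(Nat.mod_lt _ hl), ?_⟩
  funext k
  by_cases h : k < w.length
  · simp [cat, h, Nat.mod_eq_of_lt h]
  · simp [cat, h, ← Nat.mod_eq_sub_mod (not_lt.1 h)]

theorem tendsto_iterate_cat {w : List (Fin n)} (hw : w ≠ []) {q : Cantor n} (hq : cat w q = q)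
    (z : Cantor n) : Filter.Tendsto (fun k => (cat w)^[k] z) Filter.atTop (nhds q) := by
  rw [tendsto_pi_nhds]
  intro i
  apply tendsto_const_nhds.congr'
  filter_upwards [Filter.eventually_gt_atTop i] with k hk
  rw [iterate_cat_apply_eq hw z q k i hk, Function.iterate_fixed hq]

/-- A point under a node either has an infinite tail `q = w w w …` there, or it leaves the cone
of `w` after finitely many copies of `w`. -/
theorem eq_or_exists_iterate_cat {w : List (Fin n)} (hw : w ≠ []) {q : Cantor n}
    (hq : cat w q = q) (z : Cantor n) : z = q ∨ ∃ k y, z = (cat w)^[k] y ∧ y ∉ cone w := by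
  by_cases h : ∃ k y, z = (cat w)^[k] y ∧ y ∉ cone w
  · exact Or.inr h
  refine Or.inl ?_
  push Not at h
  have hall : ∀ k, ∃ y, z = (cat w)^[k] y := by
    intro k
    induction k with
    | zero => exact ⟨z, rfl⟩
    | succ k ih =>
      obtain ⟨y, hy⟩ := ih
      obtain ⟨y', rfl⟩ := h k y hy
      exact ⟨y', by rw [hy, Function.iterate_succ_apply]⟩
  funext i
  obtain ⟨y, hy⟩ := hall (i + 1)
  have := iterate_cat_apply_eq hw y q (i + 1) i (by omega)
  rwa [← hy, Function.iterate_fixed hq] at this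

/-- Over an alphabet with two letters a finite word is determined by the map that prepends it. -/
theorem eq_of_forall_cat_eq (hn : 2 ≤ n) {u v : List (Fin n)} (h : ∀ z, cat u z = cat v z) :
    u = v := by
  wlog hl : u.length ≤ v.length generalizing u v
  · exact (this (fun z => (h z).symm) (le_of_not_ge hl)).symm
  let z0 : Cantor n := fun _ => ⟨0, by omega⟩
  let z1 : Cantor n := fun _ => ⟨1, by omega⟩
  obtain ⟨t, rfl⟩ := prefix_of_cat_eq (h z0) hl
  have ht : ∀ z, cat t z = z := fun z => by
    have := h z
    rw [cat_append] at this
    exact (cat_injective u this).symm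
  by_cases h0 : t = []
  · simp [h0]
  · have := congrFun (eq_of_cat_self h0 (ht z0) (ht z1)) 0
    simp [z0, z1] at this

end Words

/-! ### Slopes as integer exponents -/

section Exponents

variable {n : ℕ}

/-- Near `r` the homeomorphism `g` has slope `(2 n - 1) ^ d`: it exchanges a prefix of `r` for
a word that is `d` letters shorter. -/
def HasExponentAt (g : Cantor n ≃ₜ Cantor n) (r : Cantor n) (d : ℤ) : Prop :=
  ∃ u v : List (Fin n), r ∈ cone u ∧ (∀ z, g (cat u z) = cat v z) ∧
    d = (u.length : ℤ) - (v.length : ℤ)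

theorem HasExponentAt.unique (hn : 2 ≤ n) {g : Cantor n ≃ₜ Cantor n} {r : Cantor n} {d d' : ℤ}
    (h : HasExponentAt g r d) (h' : HasExponentAt g r d') : d = d' := by
  obtain ⟨u, v, hu, hg, rfl⟩ := h
  obtain ⟨u', v', hu', hg', rfl⟩ := h'
  wlog hp : u <+: u' generalizing u v u' v'
  · exact (this u' v' hu' hg' u v hu hg
      ((prefix_or_prefix_of_mem_cone hu hu').resolve_left hp)).symm
  obtain ⟨t, rfl⟩ := hp
  have : v' = v ++ t := eq_of_forall_cat_eq hn fun z => by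
    rw [← hg' z, cat_append, hg, cat_append]
  subst this
  simp

theorem IsLocal.exists_hasExponentAt {g : Cantor n ≃ₜ Cantor n} (hg : IsLocal g) (r : Cantor n) :
    ∃ d, HasExponentAt g r d := by
  obtain ⟨u, v, hu, h⟩ := hg r
  exact ⟨_, u, v, hu, h, rfl⟩

theorem HasExponentAt.exists_cone_subset {g : Cantor n ≃ₜ Cantor n} {r : Cantor n} {d : ℤ}
    (h : HasExponentAt g r d) {U : Set (Cantor n)} (hU : U ∈ nhds r) :
    ∃ u v : List (Fin n), r ∈ cone u ∧ (∀ z, g (cat u z) = cat v z) ∧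
      d = (u.length : ℤ) - (v.length : ℤ) ∧ cone u ⊆ U := by
  obtain ⟨u, v, hu, hg, rfl⟩ := h
  obtain ⟨k, hk⟩ := exists_cone_pre_subset hU
  have hp : u <+: pre r (max k u.length) := by
    rcases prefix_or_prefix_of_mem_cone hu (mem_cone_pre r (max k u.length)) with h | h
    · exact h
    · rw [h.eq_of_length_le (by simp [length_pre])]
  obtain ⟨t, ht⟩ := hp
  refine ⟨u ++ t, v ++ t, ?_, fun z => by rw [cat_append, hg, cat_append], by simp, ?_⟩
  · rw [ht]
    exact mem_cone_pre _ _
  · rw [ht]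
    exact hk _ (le_max_left _ _)

theorem HasExponentAt.congr {g g' : Cantor n ≃ₜ Cantor n} {r : Cantor n} {d : ℤ}
    (h : HasExponentAt g r d) {U : Set (Cantor n)} (hU : U ∈ nhds r)
    (he : ∀ x ∈ U, g' x = g x) : HasExponentAt g' r d := by
  obtain ⟨u, v, hu, hg, hd, hs⟩ := h.exists_cone_subset hU
  exact ⟨u, v, hu, fun z => by rw [he _ (hs ⟨z, rfl⟩), hg], hd⟩

theorem hasExponentAt_one (r : Cantor n) : HasExponentAt (1 : Cantor n ≃ₜ Cantor n) r 0 :=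
  ⟨[], [], ⟨r, cat_nil r⟩, fun _ => rfl, by simp⟩

/-- The chain rule. -/
theorem HasExponentAt.mul {g f : Cantor n ≃ₜ Cantor n} {r : Cantor n} {d e : ℤ}
    (hg : HasExponentAt g (f r) d) (hf : HasExponentAt f r e) :
    HasExponentAt (g * f) r (d + e) := by
  obtain ⟨u', v', hu', hg', rfl⟩ := hg
  obtain ⟨u, v, hu, hf', rfl, hs⟩ :=
    hf.exists_cone_subset (f.continuous.continuousAt.preimage_mem_nhds
      ((isOpen_cone u').mem_nhds hu'))
  rcases prefix_or_prefix_of_mem_cone (x := f r) (u := u') (v := v) hu' (by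
    obtain ⟨z, rfl⟩ := hu
    rw [hf']
    exact cat_mem_cone _ _) with ⟨t, rfl⟩ | ⟨t, rfl⟩
  · refine ⟨u, v' ++ t, hu, fun z => ?_, by simp; ring⟩
    change g (f _) = _
    rw [hf', cat_append, hg', cat_append]
  · obtain ⟨z, rfl⟩ := hu
    obtain ⟨y, hy⟩ := hu'
    rw [hf', cat_append] at hy
    have hy' := cat_injective v hy
    refine ⟨u ++ t, v', ⟨y, by rw [cat_append, hy']⟩, fun z => ?_, by simp; ring⟩
    change g (f _) = _
    rw [cat_append, hf', ← cat_append, hg']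

open Classical in
/-- The integer `d` for which `g` has slope `(2 n - 1) ^ d` at `r` (and `0` if there is none). -/
noncomputable def exponent (g : Cantor n ≃ₜ Cantor n) (r : Cantor n) : ℤ :=
  if h : ∃ d, HasExponentAt g r d then h.choose else 0

theorem HasExponentAt.exponent_eq (hn : 2 ≤ n) {g : Cantor n ≃ₜ Cantor n} {r : Cantor n} {d : ℤ}
    (h : HasExponentAt g r d) : exponent g r = d := by
  have hex : ∃ d, HasExponentAt g r d := ⟨d, h⟩
  rw [exponent, dif_pos hex]
  exact hex.choose_spec.unique hn h

theorem IsLocal.hasExponentAt (hn : 2 ≤ n) {g : Cantor n ≃ₜ Cantor n} (hg : IsLocal g)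
    (r : Cantor n) : HasExponentAt g r (exponent g r) := by
  obtain ⟨d, hd⟩ := hg.exists_hasExponentAt r
  rwa [hd.exponent_eq hn]

theorem exponent_mul (hn : 2 ≤ n) {g f : Cantor n ≃ₜ Cantor n} (hg : IsLocal g) (hf : IsLocal f)
    (r : Cantor n) : exponent (g * f) r = exponent g (f r) + exponent f r :=
  ((hg.hasExponentAt hn _).mul (hf.hasExponentAt hn _)).exponent_eq hn

theorem slope_eq (hn : 2 ≤ n) {g : Cantor n ≃ₜ Cantor n} (hg : IsLocal g) (r : Cantor n) :
    slope g r = (2 * (n : ℝ) - 1) ^ exponent g r := by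
  have hex : ∃ m, HasSlopeAt g r m := by
    obtain ⟨u, v, hu, h⟩ := hg r
    exact ⟨_, u, v, hu, h, rfl⟩
  rw [slope, dif_pos hex]
  obtain ⟨u, v, hu, h, hm⟩ := hex.choose_spec
  rw [hm, HasExponentAt.exponent_eq hn ⟨u, v, hu, h, rfl⟩]

theorem one_lt_base (hn : 2 ≤ n) : 1 < 2 * (n : ℝ) - 1 := by
  have : (2 : ℝ) ≤ n := by exact_mod_cast hn
  linarith

theorem one_lt_slope_iff (hn : 2 ≤ n) {g : Cantor n ≃ₜ Cantor n} (hg : IsLocal g)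
    (r : Cantor n) : 1 < slope g r ↔ 0 < exponent g r := by
  rw [slope_eq hn hg, one_lt_zpow_iff_right₀ (one_lt_base hn)]

theorem logSlopeProduct_eq_sum (hn : 2 ≤ n) {g : Cantor n ≃ₜ Cantor n} (hg : IsLocal g)
    {R : Set (Cantor n)} (hR : R.Finite) :
    logSlopeProduct R g = ((∑ r ∈ hR.toFinset, exponent g r : ℤ) : ℝ) := by
  have hb := one_lt_base hn
  have h0 : (0 : ℝ) < 2 * (n : ℝ) - 1 := by linarith
  rw [logSlopeProduct, finprod_mem_eq_finite_toFinset_prod _ hR,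
    Real.logb_prod _ _ fun r _ => by rw [slope_eq hn hg]; exact (zpow_pos h0 _).ne']
  push_cast
  refine Finset.sum_congr rfl fun r _ => ?_
  rw [slope_eq hn hg, Real.logb, Real.log_zpow, mul_div_assoc,
    div_self (Real.log_pos hb).ne', mul_one]

theorem isLocal_of_mem {g : Cantor n ≃ₜ Cantor n} (hg : g ∈ V n) : IsLocal g := by
  obtain ⟨P, hP⟩ := hg
  exact TreePair.isLocal hP

theorem exponent_pow (hn : 2 ≤ n) {f : Cantor n ≃ₜ Cantor n} (hf : f ∈ V n) {r : Cantor n}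
    (hr : f r = r) (k : ℕ) : (f ^ k) r = r ∧ exponent (f ^ k) r = k * exponent f r := by
  induction k with
  | zero => exact ⟨rfl, by simpa using (hasExponentAt_one r).exponent_eq hn⟩
  | succ k ih =>
    rw [pow_succ]
    constructor
    · change (f ^ k) (f r) = r
      rw [hr, ih.1]
    · rw [exponent_mul hn (isLocal_of_mem (pow_mem hf k)) (isLocal_of_mem hf), hr, ih.2]
      push_cast
      ring

/-- The exponent at a fixed point is invariant under conjugation. -/
theorem exponent_apply_of_commute (hn : 2 ≤ n) {f g : Cantor n ≃ₜ Cantor n} (hf : f ∈ V n)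
    (hg : g ∈ V n) (hfg : Commute f g) {r : Cantor n} (hr : f r = r) :
    f (g r) = g r ∧ exponent f (g r) = exponent f r := by
  constructor
  · change (f * g) r = _
    rw [hfg.eq]
    change g (f r) = _
    rw [hr]
  · have h1 := exponent_mul hn (isLocal_of_mem hf) (isLocal_of_mem hg) r
    rw [hfg.eq, exponent_mul hn (isLocal_of_mem hg) (isLocal_of_mem hf), hr] at h1
    linarith

theorem zpow_apply_of_fixed {f : Cantor n ≃ₜ Cantor n} {r : Cantor n} (hr : f r = r) (k : ℤ) :
    (f ^ k) r = r := by
  have h : ∀ k : ℕ, (f ^ k) r = r := fun k => by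
    induction k with
    | zero => rfl
    | succ k ih =>
      rw [pow_succ]
      change (f ^ k) (f r) = r
      rw [hr, ih]
  obtain ⟨k, rfl | rfl⟩ := k.eq_nat_or_neg
  · exact h k
  · rw [zpow_neg]
    change (f ^ k).symm r = r
    rw [Homeomorph.symm_apply_eq, h]

/-- A fixed point of slope one has a neighbourhood of fixed points. -/
theorem HasExponentAt.fixed_nhds {g : Cantor n ≃ₜ Cantor n} {r : Cantor n}
    (h : HasExponentAt g r 0) (hr : g r = r) : {x | g x = x} ∈ nhds r := by
  obtain ⟨u, v, hu, hg, hd⟩ := h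
  refine Filter.mem_of_superset ((isOpen_cone u).mem_nhds hu) ?_
  obtain ⟨z, rfl⟩ := hu
  have : v = u := eq_of_cat_eq (by rw [← hg z, hr]) (by omega)
  subst this
  rintro _ ⟨y, rfl⟩
  exact hg y

/-- Away from slope one a fixed point is isolated among the fixed points; so a limit of other fixed
points has a neighbourhood of fixed points. -/
theorem IsLocal.fixed_nhds_of_frequently {g : Cantor n ≃ₜ Cantor n} (hg : IsLocal g)
    {p : Cantor n} (h : ∃ᶠ y in nhdsWithin p {p}ᶜ, g y = y) : {x | g x = x} ∈ nhds p := by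
  have hcl : IsClosed {x | g x = x} := isClosed_eq g.continuous continuous_id
  have hp : g p = p := by
    have : p ∈ closure {x | g x = x} := by
      rw [mem_closure_iff_frequently]
      exact h.filter_mono nhdsWithin_le_nhds
    rwa [hcl.closure_eq] at this
  obtain ⟨u, v, hu, hgu⟩ := hg p
  have hev : ∀ᶠ y in nhdsWithin p {p}ᶜ, y ∈ cone u ∧ y ∈ ({p}ᶜ : Set (Cantor n)) :=
    Filter.Eventually.and (nhdsWithin_le_nhds ((isOpen_cone u).mem_nhds hu)) self_mem_nhdsWithin
  obtain ⟨y, hy, hyu, hyp⟩ := (h.and_eventually hev).exists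
  apply HasExponentAt.fixed_nhds _ hp
  refine ⟨u, v, hu, hgu, ?_⟩
  obtain ⟨z0, rfl⟩ := hu
  obtain ⟨z, rfl⟩ := hyu
  have hz : z ≠ z0 := fun h => hyp (by simp [h])
  rw [hgu] at hp hy
  rcases le_total u.length v.length with hl | hl
  · obtain ⟨t, rfl⟩ := prefix_of_cat_eq hp.symm hl
    rw [cat_append] at hp hy
    by_cases ht : t = []
    · simp [ht]
    · exact absurd (eq_of_cat_self ht (cat_injective _ hp) (cat_injective _ hy)) hz
  · obtain ⟨t, rfl⟩ := prefix_of_cat_eq hp hl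
    rw [cat_append] at hp hy
    by_cases ht : t = []
    · simp [ht]
    · exact absurd (eq_of_cat_self ht (cat_injective _ hp).symm (cat_injective _ hy).symm) hz

end Exponents

/-! ### Leaves of finite trees -/

section Leaves

variable {n : ℕ}

theorem NTree.mem_of_prefix (T : NTree n) {u v : List (Fin n)} (h : u <+: v) (hv : v ∈ T.nodes) :
    u ∈ T.nodes := by
  obtain ⟨t, rfl⟩ := h
  induction t using List.reverseRecOn with
  | nil => simpa using hv
  | append_singleton t i ih => exact ih (T.parent_mem _ i (by simpa using hv))

theorem NTree.leaf_eq_of_prefix (T : NTree n) {u v : List (Fin n)} (hu : u ∈ T.leaves)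
    (hv : v ∈ T.nodes) (h : u <+: v) : u = v := by
  obtain ⟨t, rfl⟩ := h
  cases t with
  | nil => simp
  | cons i t => exact absurd (T.mem_of_prefix ⟨t, by simp⟩ hv) (hu.2 i)

theorem NTree.leaf_eq_of_mem_cone (T : NTree n) {u v : List (Fin n)} {x : Cantor n}
    (hu : u ∈ T.leaves) (hv : v ∈ T.leaves) (hxu : x ∈ cone u) (hxv : x ∈ cone v) : u = v := by
  rcases prefix_or_prefix_of_mem_cone hxu hxv with h | h
  · exact T.leaf_eq_of_prefix hu hv.1 h
  · exact (T.leaf_eq_of_prefix hv hu.1 h).symm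

theorem NTree.finite_leaves (T : NTree n) : T.leaves.Finite := T.finite.subset fun _ h => h.1

theorem NTree.leaf_eq_of_prefix_of_prefix (T : NTree n) {u v w : List (Fin n)}
    (hu : u ∈ T.leaves) (hv : v ∈ T.leaves) (hu' : u <+: w) (hv' : v <+: w) : u = v := by
  rcases List.prefix_or_prefix_of_prefix hu' hv' with h | h
  · exact T.leaf_eq_of_prefix hu hv.1 h
  · exact (T.leaf_eq_of_prefix hv hu.1 h).symm

theorem NTree.exists_leaf_prefix (hn : 0 < n) (T : NTree n) {u : List (Fin n)}
    (hu : u ∉ T.nodes) : ∃ w ∈ T.leaves, w <+: u := by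
  obtain ⟨w, hw, hx⟩ := T.exists_leaf (cat u fun _ => ⟨0, hn⟩)
  refine ⟨w, hw, (prefix_or_prefix_of_mem_cone hx (cat_mem_cone u _)).resolve_right fun h => ?_⟩
  exact hu (T.mem_of_prefix h hw.1)

theorem NTree.exists_leaf_of_mem_cone (T : NTree n) {u : List (Fin n)} (hu : u ∈ T.nodes)
    {x : Cantor n} (hx : x ∈ cone u) : ∃ w ∈ T.leaves, x ∈ cone w ∧ u <+: w := by
  obtain ⟨w, hw, hxw⟩ := T.exists_leaf x
  refine ⟨w, hw, hxw, ?_⟩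
  rcases prefix_or_prefix_of_mem_cone hx hxw with h | h
  · exact h
  · rw [T.leaf_eq_of_prefix hw hu h]

end Leaves

namespace TreePair

variable {n : ℕ} {P : TreePair n}

/-! ### The inverse tree pair -/

/-- The tree pair `(B, A, σ⁻¹)`, which represents the inverse homeomorphism. It exchanges repellers
and attractors, and sources and sinks. -/
def dual (P : TreePair n) : TreePair n := ⟨P.B, P.A, P.σ.symm⟩

theorem maps_dual {a b : List (Fin n)} : P.dual.Maps b a ↔ P.Maps a b := by
  constructor
  · rintro ⟨h, rfl⟩
    exact ⟨(P.σ.symm ⟨b, h⟩).2, congrArg Subtype.val (P.σ.apply_symm_apply ⟨b, h⟩)⟩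
  · rintro ⟨h, rfl⟩
    exact ⟨(P.σ ⟨a, h⟩).2, congrArg Subtype.val (P.σ.symm_apply_apply ⟨a, h⟩)⟩

theorem IsChain.dual {γ : ℕ → List (Fin n)} {s : ℕ} (h : P.IsChain γ s) :
    P.dual.IsChain (fun i => γ (s - i)) s := by
  obtain ⟨h1, h2, h3, h4, h5⟩ := h
  refine ⟨h4, h5, fun i hi => maps_dual.2 ?_,
    by simpa using (show γ 0 ∈ P.dual.B.leaves from h1),
    by simpa using (show γ 0 ∉ P.dual.A.leaves from h2)⟩
  have := h3 (s - (i + 1)) (by omega)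
  rwa [show s - (i + 1) + 1 = s - i by omega] at this

theorem isRepeller_dual {a : List (Fin n)} : P.dual.IsRepeller a ↔ P.IsAttractor a := by
  constructor
  · rintro ⟨γ, s, h, rfl, hp⟩
    exact ⟨_, s, h.dual, by simp, by simpa using hp⟩
  · rintro ⟨γ, s, h, rfl, hp⟩
    exact ⟨_, s, h.dual, by simp, by simpa using hp⟩

theorem isAttractor_dual {a : List (Fin n)} : P.dual.IsAttractor a ↔ P.IsRepeller a :=
  isRepeller_dual (P := P.dual).symm

theorem isSink_dual {a : List (Fin n)} : P.dual.IsSink a ↔ P.IsSource a := by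
  unfold IsSink IsSource
  rw [isAttractor_dual]
  rfl

theorem isSource_dual {a : List (Fin n)} : P.dual.IsSource a ↔ P.IsSink a :=
  isSink_dual (P := P.dual).symm

theorem IsRevealing.dual (h : P.IsRevealing) : P.dual.IsRevealing :=
  ⟨fun ρ hρ => by simpa only [isRepeller_dual] using h.2 ρ hρ,
    fun ρ hρ => by simpa only [isAttractor_dual] using h.1 ρ hρ⟩

/-! ### Chains of leaves -/

theorem Maps.mem_left {a b : List (Fin n)} (h : P.Maps a b) : a ∈ P.A.leaves := h.1

theorem Maps.mem_right {a b : List (Fin n)} (h : P.Maps a b) : b ∈ P.B.leaves := by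
  obtain ⟨h, rfl⟩ := h
  exact (P.σ ⟨a, h⟩).2

theorem Maps.right_unique {a b b' : List (Fin n)} (h : P.Maps a b) (h' : P.Maps a b') :
    b = b' := by
  obtain ⟨_, rfl⟩ := h
  obtain ⟨_, rfl⟩ := h'
  rfl

theorem Maps.left_unique {a a' b : List (Fin n)} (h : P.Maps a b) (h' : P.Maps a' b) : a = a' :=
  (maps_dual.2 h).right_unique (maps_dual.2 h')

theorem IsChain.pos {γ : ℕ → List (Fin n)} {s : ℕ} (h : P.IsChain γ s) : 0 < s := by
  rcases Nat.eq_zero_or_pos s with rfl | hs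
  · exact absurd h.2.2.2.1 h.2.1
  · exact hs

theorem IsChain.mem_A {γ : ℕ → List (Fin n)} {s : ℕ} (h : P.IsChain γ s) {i : ℕ} (hi : i < s) :
    γ i ∈ P.A.leaves := (h.2.2.1 i hi).mem_left

theorem IsChain.eq_of_start {γ γ' : ℕ → List (Fin n)} {s s' : ℕ} (h : P.IsChain γ s)
    (h' : P.IsChain γ' s') (h0 : γ 0 = γ' 0) : s = s' ∧ ∀ i ≤ s, γ i = γ' i := by
  have key : ∀ i, i ≤ s → i ≤ s' → γ i = γ' i := by
    intro i
    induction i with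
    | zero => intros; exact h0
    | succ i ih =>
      intro h1 h2
      have h3 := h.2.2.1 i h1
      rw [ih (by omega) (by omega)] at h3
      exact h3.right_unique (h'.2.2.1 i h2)
  have hs : s = s' := by
    rcases lt_trichotomy s s' with hl | hl | hl
    · have := h'.mem_A hl
      rw [← key s le_rfl hl.le] at this
      exact absurd this h.2.2.2.2
    · exact hl
    · have := h.mem_A hl
      rw [key s' hl.le le_rfl] at this
      exact absurd this h'.2.2.2.2
  subst hs
  exact ⟨rfl, fun i hi => key i hi hi⟩

theorem IsChain.start_eq_of_end {γ γ' : ℕ → List (Fin n)} {s s' : ℕ} (h : P.IsChain γ s)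
    (h' : P.IsChain γ' s') (h0 : γ s = γ' s') : γ 0 = γ' 0 := by
  obtain ⟨rfl, h1⟩ := h.dual.eq_of_start h'.dual (by simpa using h0)
  simpa using h1 s le_rfl

/-- The iterates of `σ` that start at a leaf of `A` outside `B` are distinct, so there are finitely
many. -/
theorem exists_isChain {a : List (Fin n)} (ha : a ∈ P.A.leaves) (ha' : a ∉ P.B.leaves) :
    ∃ γ s, P.IsChain γ s ∧ γ 0 = a := by
  classical
  let F : List (Fin n) → List (Fin n) := fun w =>
    if h : w ∈ P.A.leaves then (P.σ ⟨w, h⟩ : List (Fin n)) else w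
  have hF : ∀ w ∈ P.A.leaves, P.Maps w (F w) := fun w hw => ⟨hw, by simp [F, hw]⟩
  have hex : ∃ k, F^[k] a ∉ P.A.leaves := by
    by_contra! hall
    have hm : ∀ k, P.Maps (F^[k] a) (F^[k + 1] a) := fun k => by
      rw [Function.iterate_succ_apply']
      exact hF _ (hall k)
    have hne : ∀ i k, F^[i] a ≠ F^[i + (k + 1)] a := by
      intro i k
      induction i with
      | zero =>
        intro h
        apply ha'
        rw [zero_add] at h
        have := (hm k).mem_right
        rwa [← h] at this
      | succ i ih =>
        intro h
        have h1 := hm i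
        rw [h, show i + 1 + (k + 1) = i + (k + 1) + 1 by ring] at h1
        exact ih (h1.left_unique (hm _))
    have hinj : Function.Injective fun k => F^[k] a := by
      intro i j hij
      rcases lt_trichotomy i j with hl | hl | hl
      · obtain ⟨k, rfl⟩ := Nat.exists_eq_add_of_lt hl
        exact absurd hij (hne i k)
      · exact hl
      · obtain ⟨k, rfl⟩ := Nat.exists_eq_add_of_lt hl
        exact absurd hij.symm (hne j k)
    exact Set.infinite_range_of_injective hinj
      (P.A.finite_leaves.subset (by rintro _ ⟨k, rfl⟩; exact hall k))
  have hlt : ∀ k < Nat.find hex, F^[k] a ∈ P.A.leaves := fun k hk => by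
    simpa using Nat.find_min hex hk
  have hmap : ∀ i < Nat.find hex, P.Maps (F^[i] a) (F^[i + 1] a) := fun i hi => by
    rw [Function.iterate_succ_apply']
    exact hF _ (hlt i hi)
  refine ⟨fun k => F^[k] a, Nat.find hex, ⟨ha, ha', hmap, ?_, Nat.find_spec hex⟩, rfl⟩
  rcases h0 : Nat.find hex with _ | m
  · have := Nat.find_spec hex
    rw [h0] at this
    exact absurd ha this
  · exact (hmap m (by omega)).mem_right

/-! ### Components of the difference of the trees -/

theorem IsRepeller.mem_A {a : List (Fin n)} (h : P.IsRepeller a) : a ∈ P.A.leaves := by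
  obtain ⟨γ, s, h, rfl, -⟩ := h
  exact h.1

theorem IsRepeller.notMem_B {a : List (Fin n)} (h : P.IsRepeller a) : a ∉ P.B.leaves := by
  obtain ⟨γ, s, h, rfl, -⟩ := h
  exact h.2.1

theorem IsAttractor.mem_B {b : List (Fin n)} (h : P.IsAttractor b) : b ∈ P.B.leaves :=
  (isRepeller_dual.2 h).mem_A

theorem IsAttractor.notMem_A {b : List (Fin n)} (h : P.IsAttractor b) : b ∉ P.A.leaves :=
  (isRepeller_dual.2 h).notMem_B

theorem IsRepeller.not_isAttractor {a : List (Fin n)} (h : P.IsRepeller a) :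
    ¬ P.IsAttractor a := fun h' => h'.notMem_A h.mem_A

theorem IsRepeller.exists_root {a : List (Fin n)} (h : P.IsRepeller a) :
    ∃ γ s, P.IsChain γ s ∧ γ 0 = a ∧ γ s <+: a ∧ γ s ∈ P.domRoots := by
  obtain ⟨γ, s, h, rfl, hp⟩ := h
  exact ⟨γ, s, h, rfl, hp, h.2.2.2.1, P.A.mem_of_prefix hp h.1.1, h.2.2.2.2⟩

/-- The chain of a repeller ends at the root of its component. -/
theorem IsRepeller.exists_chain_of_root {a ρ : List (Fin n)} (h : P.IsRepeller a)
    (hρ : ρ ∈ P.domRoots) (hp : ρ <+: a) : ∃ γ s, P.IsChain γ s ∧ γ 0 = a ∧ γ s = ρ := by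
  obtain ⟨γ, s, hc, h0, hp', hr⟩ := h.exists_root
  exact ⟨γ, s, hc, h0, P.B.leaf_eq_of_prefix_of_prefix hr.1 hρ.1 hp' hp⟩

/-- A component of `A - B` has only one repeller, and all its other leaves are sources. -/
theorem exists_isSource_of_mem_cone {a ρ : List (Fin n)} (ha : P.IsRepeller a)
    (hρ : ρ ∈ P.domRoots) (hp : ρ <+: a) {x : Cantor n} (hx : x ∈ cone ρ) (hxa : x ∉ cone a) :
    ∃ c, P.IsSource c ∧ ρ <+: c ∧ x ∈ cone c := by
  obtain ⟨c, hc, hxc, hρc⟩ := P.A.exists_leaf_of_mem_cone hρ.2.1 hx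
  refine ⟨c, ⟨hc, ⟨ρ, hρ, hρc⟩, fun hr => ?_⟩, hρc, hxc⟩
  obtain ⟨γ, s, h, h0, h1⟩ := ha.exists_chain_of_root hρ hp
  obtain ⟨γ', s', h', h0', h1'⟩ := hr.exists_chain_of_root hρ hρc
  have := h.start_eq_of_end h' (h1.trans h1'.symm)
  rw [h0, h0'] at this
  exact hxa (this ▸ hxc)

theorem exists_isSink_of_mem_cone {b ρ : List (Fin n)} (hb : P.IsAttractor b)
    (hρ : ρ ∈ P.ranRoots) (hp : ρ <+: b) {x : Cantor n} (hx : x ∈ cone ρ) (hxb : x ∉ cone b) :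
    ∃ d, P.IsSink d ∧ ρ <+: d ∧ x ∈ cone d := by
  obtain ⟨d, hd, h⟩ := exists_isSource_of_mem_cone (P := P.dual) (isRepeller_dual.2 hb) hρ hp hx hxb
  exact ⟨d, isSource_dual.1 hd, h⟩

/-- In a revealing pair the chain of a source ends in a sink. -/
theorem IsSource.exists_chain (hn : 0 < n) (hrev : P.IsRevealing) {c : List (Fin n)}
    (hc : P.IsSource c) : ∃ γ s, P.IsChain γ s ∧ γ 0 = c ∧ P.IsSink (γ s) := by
  obtain ⟨hcA, ⟨ρ, hρ, hρc⟩, hnr⟩ := hc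
  have hcB : c ∉ P.B.leaves := fun h => by
    have := P.B.leaf_eq_of_prefix hρ.1 h.1 hρc
    exact hρ.2.2 (this ▸ hcA)
  obtain ⟨γ, s, h, h0⟩ := exists_isChain hcA hcB
  refine ⟨γ, s, h, h0, h.2.2.2.1, ?_, ?_⟩
  · have hA : γ s ∉ P.A.nodes := by
      intro hA
      have hdom : γ s ∈ P.domRoots := ⟨h.2.2.2.1, hA, h.2.2.2.2⟩
      obtain ⟨a, ha, hpa⟩ := hrev.1 _ hdom
      obtain ⟨γ', s', h', h0', h1'⟩ := ha.exists_chain_of_root hdom hpa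
      have := h.start_eq_of_end h' h1'.symm
      rw [h0, h0'] at this
      exact hnr (this ▸ ha)
    obtain ⟨w, hw, hwp⟩ := P.A.exists_leaf_prefix hn hA
    refine ⟨w, ⟨hw, P.B.mem_of_prefix hwp h.2.2.2.1.1, fun hwB => ?_⟩, hwp⟩
    have := P.B.leaf_eq_of_prefix hwB h.2.2.2.1.1 hwp
    exact hA (this ▸ hw.1)
  · rintro ⟨γ', s', h', h1', hp⟩
    have h2 := h.start_eq_of_end h' h1'.symm
    rw [← h2, h0] at hp
    have h3 := P.B.leaf_eq_of_prefix hρ.1 h.2.2.2.1.1 (hρc.trans hp)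
    rw [← h3] at hp
    have h4 := hp.eq_of_length_le hρc.length_le
    exact hρ.2.2 (h4 ▸ hcA)

theorem IsSink.exists_chain (hn : 0 < n) (hrev : P.IsRevealing) {d : List (Fin n)}
    (hd : P.IsSink d) : ∃ γ s, P.IsChain γ s ∧ γ s = d ∧ P.IsSource (γ 0) := by
  obtain ⟨γ, s, h, h0, h1⟩ := (isSource_dual.2 hd).exists_chain hn hrev.dual
  exact ⟨_, s, h.dual, by simpa using h0, by simpa using isSink_dual.1 h1⟩

theorem IsSource.exists_isFlowLine (hn : 0 < n) (hrev : P.IsRevealing) {a c ρ : List (Fin n)}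
    (hc : P.IsSource c) (ha : P.IsRepeller a) (hρ : ρ ∈ P.domRoots) (hρa : ρ <+: a)
    (hρc : ρ <+: c) : ∃ b, P.IsFlowLine a b c := by
  obtain ⟨γ, s, h, h0, h1⟩ := hc.exists_chain hn hrev
  obtain ⟨ρ', hρ', hp⟩ := h1.2.1
  obtain ⟨b, hb, hpb⟩ := hrev.2 ρ' hρ'
  exact ⟨b, ha, hb, hc, ⟨ρ, hρ, hρa, hρc⟩, γ, s, h, h0, h1, ρ', hρ', hpb, hp⟩

theorem IsSink.exists_isFlowLine (hn : 0 < n) (hrev : P.IsRevealing) {b d ρ : List (Fin n)}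
    (hd : P.IsSink d) (hb : P.IsAttractor b) (hρ : ρ ∈ P.ranRoots) (hρb : ρ <+: b)
    (hρd : ρ <+: d) : ∃ a γ s, P.IsChain γ s ∧ γ s = d ∧ P.IsFlowLine a b (γ 0) := by
  obtain ⟨γ, s, h, h0, h1⟩ := hd.exists_chain hn hrev
  obtain ⟨ρ', hρ', hp⟩ := h1.2.1
  obtain ⟨a, ha, hpa⟩ := hrev.1 ρ' hρ'
  exact ⟨a, γ, s, h, h0, ha, hb, h1, ⟨ρ', hρ', hpa, hp⟩, γ, s, h, rfl, h0 ▸ hd, ρ, hρ, hρb,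
    h0 ▸ hρd⟩

/-! ### Vertices of a non-torsion component -/

/-- `ρ` is the root of the component of `A - B` or `B - A` that contains the repeller or
attractor `v`. -/
def IsRoot (P : TreePair n) (v ρ : List (Fin n)) : Prop :=
  (P.IsRepeller v ∧ ρ ∈ P.domRoots ∧ ρ <+: v) ∨ (P.IsAttractor v ∧ ρ ∈ P.ranRoots ∧ ρ <+: v)

theorem exists_isRoot {v : List (Fin n)} (h : P.IsRepeller v ∨ P.IsAttractor v) :
    ∃ ρ, P.IsRoot v ρ := by
  rcases h with h | h
  · obtain ⟨γ, s, -, -, h1, h2⟩ := h.exists_root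
    exact ⟨_, Or.inl ⟨h, h2, h1⟩⟩
  · obtain ⟨γ, s, -, -, h1, h2⟩ := (isRepeller_dual.2 h).exists_root
    exact ⟨_, Or.inr ⟨h, h2, h1⟩⟩

/-- The node `v` is a vertex of the component `Γ` of the flow graph. -/
def Mem (P : TreePair n) (Γ : P.flowGraph.ConnectedComponent) (v : List (Fin n)) : Prop :=
  ∃ u ∈ Γ.supp, u.1 = v

variable {α : Cantor n ≃ₜ Cantor n} {Γ : P.flowGraph.ConnectedComponent}

theorem IsPeriodicLeaf.mem_A {a : List (Fin n)} (h : P.IsPeriodicLeaf a) : a ∈ P.A.leaves := by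
  obtain ⟨b, hb, -⟩ := Relation.TransGen.head'_iff.1 h
  exact hb.mem_left

theorem IsPeriodicLeaf.mem_B {a : List (Fin n)} (h : P.IsPeriodicLeaf a) : a ∈ P.B.leaves := by
  obtain ⟨b, -, hb⟩ := Relation.TransGen.tail'_iff.1 h
  exact hb.mem_right

/-- A property that is transported along flow lines in both directions spreads from one repeller or
attractor of a component to all vertices of the component. -/
theorem Mem.induction {C : List (Fin n) → Prop}
    (hC : ∀ a b c, P.Mem Γ a → P.Mem Γ b → P.IsFlowLine a b c → (C a ↔ C b))
    {v w : List (Fin n)} (hv : P.Mem Γ v) (hw : P.Mem Γ w)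
    (hvr : P.IsRepeller v ∨ P.IsAttractor v) (h : C v) : C w := by
  obtain ⟨v, hvΓ, rfl⟩ := hv
  obtain ⟨w, hwΓ, rfl⟩ := hw
  have hreach : P.flowGraph.Reachable v w :=
    SimpleGraph.ConnectedComponent.exact (hvΓ.trans hwΓ.symm)
  obtain ⟨p⟩ := hreach
  induction p with
  | nil => exact h
  | @cons u v w hadj p ih =>
    have hvΓ' : v ∈ Γ.supp := by
      have := SimpleGraph.ConnectedComponent.sound hadj.reachable
      exact this.symm.trans hvΓ
    have hper : ¬ P.IsPeriodicLeaf u.1 := fun hp => by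
      rcases hvr with h | h
      · exact h.notMem_B hp.mem_B
      · exact h.notMem_A hp.mem_A
    obtain ⟨-, (⟨c, hc⟩ | hp) | ⟨c, hc⟩ | hp⟩ := (SimpleGraph.fromRel_adj _ _ _).1 hadj
    · exact ih hvΓ' (Or.inr hc.2.1) ((hC _ _ c ⟨_, hvΓ, rfl⟩ ⟨_, hvΓ', rfl⟩ hc).1 h) hwΓ
    · exact absurd hp.1 hper
    · exact ih hvΓ' (Or.inl hc.1) ((hC _ _ c ⟨_, hvΓ', rfl⟩ ⟨_, hvΓ, rfl⟩ hc).2 h) hwΓ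
    · exact absurd hp.2.1 hper

theorem IsFlowLine.mem_iff {a b c : List (Fin n)} (h : P.IsFlowLine a b c) :
    P.Mem Γ a ↔ P.Mem Γ b := by
  let u : P.FlowVertex := ⟨a, Or.inl h.1⟩
  let v : P.FlowVertex := ⟨b, Or.inr (Or.inl h.2.1)⟩
  have hadj : P.flowGraph.Adj u v := by
    refine (SimpleGraph.fromRel_adj _ _ _).2 ⟨fun he => ?_, Or.inl (Or.inl ⟨c, h⟩)⟩
    have : a = b := congrArg Subtype.val he
    exact h.1.not_isAttractor (this ▸ h.2.1)
  have hs := SimpleGraph.ConnectedComponent.sound hadj.reachable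
  constructor
  · rintro ⟨u', hu', rfl⟩
    exact ⟨v, hs.symm.trans hu', rfl⟩
  · rintro ⟨v', hv', rfl⟩
    exact ⟨u, hs.trans hv', rfl⟩

/-! ### The action on chains and components -/

theorem Represents.apply_of_maps (hP : P.Represents α) {a b : List (Fin n)} (h : P.Maps a b)
    (z : Cantor n) : α (cat a z) = cat b z := by
  obtain ⟨h, rfl⟩ := h
  exact hP ⟨a, h⟩ z

theorem Represents.pow_apply_start (hP : P.Represents α) {γ : ℕ → List (Fin n)} {s : ℕ}
    (h : P.IsChain γ s) (z : Cantor n) : ∀ i ≤ s, (α ^ i) (cat (γ 0) z) = cat (γ i) z := by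
  intro i
  induction i with
  | zero => intro _; rfl
  | succ i ih =>
    intro hi
    rw [pow_succ']
    change α ((α ^ i) _) = _
    rw [ih (by omega), hP.apply_of_maps (h.2.2.1 i hi)]

theorem zpow_add_apply (α : Cantor n ≃ₜ Cantor n) (j k : ℤ) (x : Cantor n) :
    (α ^ (j + k)) x = (α ^ j) ((α ^ k) x) := by
  rw [zpow_add]
  rfl

theorem Represents.zpow_apply_chain (hP : P.Represents α) {γ : ℕ → List (Fin n)} {s : ℕ}
    (h : P.IsChain γ s) {i j : ℕ} (hi : i ≤ s) (hj : j ≤ s) (z : Cantor n) :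
    (α ^ ((j : ℤ) - i)) (cat (γ i) z) = cat (γ j) z := by
  rw [← hP.pow_apply_start h z i hi, ← hP.pow_apply_start h z j hj, ← zpow_natCast,
    ← zpow_add_apply, sub_add_cancel, zpow_natCast]

theorem zpow_mul_apply_cat {ρ ω : List (Fin n)} {e : ℤ}
    (h : ∀ z, (α ^ e) (cat ρ z) = cat ρ (cat ω z)) (k : ℕ) (z : Cantor n) :
    (α ^ (e * k)) (cat ρ z) = cat ρ ((cat ω)^[k] z) := by
  induction k with
  | zero => simp
  | succ k ih =>
    push_cast
    rw [mul_add, mul_one, add_comm, zpow_add_apply, ih, h, Function.iterate_succ_apply']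

/-- Under the root `ρ` of the component of a repeller or attractor `v = ρ ω`, some power of the
represented element (a negative one for a repeller) prepends `ω`. -/
theorem IsRoot.exists_spine (hP : P.Represents α) {v ρ : List (Fin n)} (h : P.IsRoot v ρ) :
    ∃ (ω : List (Fin n)) (e : ℤ), v = ρ ++ ω ∧ ω ≠ [] ∧ (∀ z, (α ^ e) (cat ρ z) = cat ρ (cat ω z)) ∧
      ((P.IsRepeller v ∧ e < 0) ∨ (P.IsAttractor v ∧ 0 < e)) := by
  rcases h with ⟨hv, hρ, ω, rfl⟩ | ⟨hv, hρ, ω, rfl⟩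
  · obtain ⟨γ, s, h, h0, h1⟩ := hv.exists_chain_of_root hρ ⟨ω, rfl⟩
    refine ⟨ω, -s, rfl, ?_, fun z => ?_, Or.inl ⟨hv, by have := h.pos; omega⟩⟩
    · rintro rfl
      exact hρ.2.2 (by simpa using hv.mem_A)
    · have := hP.zpow_apply_chain h le_rfl (Nat.zero_le s) z
      rw [h0, h1, cat_append] at this
      simpa using this
  · obtain ⟨γ, s, h, h0, h1⟩ := (isRepeller_dual.2 hv).exists_chain_of_root hρ ⟨ω, rfl⟩
    have h2 := h.dual
    refine ⟨ω, s, rfl, ?_, fun z => ?_, Or.inr ⟨hv, by have := h.pos; omega⟩⟩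
    · rintro rfl
      exact hρ.2.2 (by simpa using hv.mem_B)
    · have := hP.zpow_apply_chain h2 (Nat.zero_le s) le_rfl z
      simp only [Nat.sub_zero, Nat.sub_self] at this
      rw [h0, h1, cat_append] at this
      simpa using this

/-! ### The support is clopen -/

/-- The union of the orbits of the cones of the sources of `Γ`; the support is the closure. -/
def sourceOrbits (P : TreePair n) (α : Cantor n ≃ₜ Cantor n)
    (Γ : P.flowGraph.ConnectedComponent) : Set (Cantor n) :=
  {x | ∃ u ∈ Γ.supp, ∃ v ∈ Γ.supp, ∃ c, P.IsFlowLine u.1 v.1 c ∧ ∃ k : ℤ, x ∈ (α ^ k) '' cone c}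

theorem mem_sourceOrbits_iff {x : Cantor n} : x ∈ P.sourceOrbits α Γ ↔
    ∃ a b c, P.Mem Γ a ∧ P.IsFlowLine a b c ∧ ∃ k : ℤ, (α ^ k) x ∈ cone c := by
  constructor
  · rintro ⟨u, hu, v, hv, c, hc, k, y, hy, rfl⟩
    refine ⟨u.1, v.1, c, ⟨u, hu, rfl⟩, hc, -k, ?_⟩
    rwa [← zpow_add_apply, neg_add_cancel]
  · rintro ⟨a, b, c, ha, hc, k, hx⟩
    obtain ⟨v, hv, rfl⟩ := hc.mem_iff.1 ha
    obtain ⟨u, hu, rfl⟩ := ha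
    refine ⟨u, hu, v, hv, c, hc, -k, _, hx, ?_⟩
    rw [← zpow_add_apply, neg_add_cancel]
    rfl

theorem zpow_apply_mem_sourceOrbits {x : Cantor n} (hx : x ∈ P.sourceOrbits α Γ) (k : ℤ) :
    (α ^ k) x ∈ P.sourceOrbits α Γ := by
  rw [mem_sourceOrbits_iff] at hx ⊢
  obtain ⟨a, b, c, ha, hc, j, hj⟩ := hx
  exact ⟨a, b, c, ha, hc, j - k, by rwa [← zpow_add_apply, sub_add_cancel]⟩

theorem zpow_apply_mem_support {x : Cantor n} (hx : x ∈ P.support α Γ) (k : ℤ) :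
    (α ^ k) x ∈ P.support α Γ :=
  map_mem_closure (α ^ k).continuous hx fun _ h => zpow_apply_mem_sourceOrbits h k

/-- The part of a component of the difference of the trees that lies outside the spine is covered by
orbits of sources. -/
theorem IsRoot.mem_sourceOrbits (hn : 0 < n) (hP : P.Represents α) (hrev : P.IsRevealing)
    {v ρ : List (Fin n)} (hv : P.Mem Γ v) (h : P.IsRoot v ρ) {x : Cantor n} (hx : x ∈ cone ρ)
    (hxv : x ∉ cone v) : x ∈ P.sourceOrbits α Γ := by
  rw [mem_sourceOrbits_iff]
  rcases h with ⟨hr, hρ, hp⟩ | ⟨hr, hρ, hp⟩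
  · obtain ⟨c, hc, hρc, hxc⟩ := exists_isSource_of_mem_cone hr hρ hp hx hxv
    obtain ⟨b, hb⟩ := hc.exists_isFlowLine hn hrev hr hρ hp hρc
    exact ⟨v, b, c, hv, hb, 0, hxc⟩
  · obtain ⟨d, hd, hρd, z, rfl⟩ := exists_isSink_of_mem_cone hr hρ hp hx hxv
    obtain ⟨a, γ, s, h, rfl, hf⟩ := hd.exists_isFlowLine hn hrev hr hρ hp hρd
    refine ⟨a, v, γ 0, hf.mem_iff.2 hv, hf, ((0 : ℕ) : ℤ) - s, ?_⟩
    rw [hP.zpow_apply_chain h le_rfl (Nat.zero_le s)]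
    exact cat_mem_cone _ _

theorem exists_notMem_cone (hn : 2 ≤ n) {ω : List (Fin n)} (hω : ω ≠ []) :
    ∃ y : Cantor n, y ∉ cone ω := by
  obtain ⟨i, t, rfl⟩ := List.exists_cons_of_ne_nil hω
  have : Nontrivial (Fin n) := Fin.nontrivial_iff_two_le.2 hn
  obtain ⟨j, hj⟩ := exists_ne i
  refine ⟨fun _ => j, ?_⟩
  rintro ⟨z, hz⟩
  have := congrFun hz 0
  simp [cat] at this
  exact hj this.symm

theorem cat_mem_cone_append_iff {ρ ω : List (Fin n)} {y : Cantor n} :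
    cat ρ y ∈ cone (ρ ++ ω) ↔ y ∈ cone ω := by
  constructor
  · rintro ⟨z, hz⟩
    rw [cat_append] at hz
    exact ⟨z, cat_injective ρ hz⟩
  · rintro ⟨z, rfl⟩
    exact ⟨z, cat_append _ _ _⟩

theorem IsRoot.cone_subset_support (hn : 2 ≤ n) (hP : P.Represents α) (hrev : P.IsRevealing)
    {v ρ : List (Fin n)} (hv : P.Mem Γ v) (h : P.IsRoot v ρ) : cone ρ ⊆ P.support α Γ := by
  obtain ⟨ω, e, rfl, hω, he, -⟩ := h.exists_spine hP
  obtain ⟨q, hq⟩ := exists_cat_self hω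
  have hout : ∀ y, y ∉ cone ω → ∀ k : ℕ, cat ρ ((cat ω)^[k] y) ∈ P.sourceOrbits α Γ := by
    intro y hy k
    rw [← zpow_mul_apply_cat he]
    exact zpow_apply_mem_sourceOrbits (h.mem_sourceOrbits (by omega) hP hrev hv
      (cat_mem_cone _ _) (by rwa [cat_mem_cone_append_iff])) _
  rintro _ ⟨z, rfl⟩
  rcases eq_or_exists_iterate_cat hω hq z with rfl | ⟨k, y, rfl, hy⟩
  · obtain ⟨y, hy⟩ := exists_notMem_cone hn hω
    exact mem_closure_of_tendsto (((continuous_cat ρ).tendsto _).comp (tendsto_iterate_cat hω hq y))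
      (Filter.Eventually.of_forall (hout y hy))
  · exact subset_closure (hout y hy k)

/-- The chain is one of a repeller, an attractor or a flow line of `Γ`. -/
def IsChainOf (P : TreePair n) (Γ : P.flowGraph.ConnectedComponent) (γ : ℕ → List (Fin n))
    (s : ℕ) : Prop :=
  P.IsChain γ s ∧ ((P.IsRepeller (γ 0) ∧ P.Mem Γ (γ 0) ∧ P.IsRoot (γ 0) (γ s)) ∨
    (P.IsAttractor (γ s) ∧ P.Mem Γ (γ s) ∧ P.IsRoot (γ s) (γ 0)) ∨
    ∃ a b ρ ρ', P.Mem Γ a ∧ P.IsFlowLine a b (γ 0) ∧ ρ ∈ P.domRoots ∧ ρ <+: a ∧ ρ <+: γ 0 ∧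
      ρ' ∈ P.ranRoots ∧ ρ' <+: b ∧ ρ' <+: γ s)

theorem IsFlowLine.exists_isChainOf {a b c : List (Fin n)} (ha : P.Mem Γ a)
    (h : P.IsFlowLine a b c) : ∃ γ s, P.IsChainOf Γ γ s ∧ γ 0 = c := by
  obtain ⟨ρ, hρ, hρa, hρc⟩ := h.2.2.2.1
  obtain ⟨γ, s, hc, rfl, hs, ρ', hρ', hρb, hρs⟩ := h.2.2.2.2
  exact ⟨γ, s, ⟨hc, Or.inr (Or.inr ⟨a, b, ρ, ρ', ha, h, hρ, hρa, hρc, hρ', hρb, hρs⟩)⟩, rfl⟩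

theorem IsFlowLine.isChainOf {a b : List (Fin n)} {γ : ℕ → List (Fin n)} {s : ℕ}
    (hc : P.IsChain γ s) (ha : P.Mem Γ a) (h : P.IsFlowLine a b (γ 0)) : P.IsChainOf Γ γ s := by
  obtain ⟨γ', s', ⟨hc', hT⟩, h0⟩ := h.exists_isChainOf ha
  obtain ⟨rfl, h1⟩ := hc.eq_of_start hc' h0.symm
  refine ⟨hc, ?_⟩
  rw [h1 0 (Nat.zero_le _), h1 s le_rfl]
  exact hT

theorem IsRepeller.exists_isChainOf {a ρ : List (Fin n)} (h : P.IsRepeller a) (ha : P.Mem Γ a)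
    (hρ : ρ ∈ P.domRoots) (hp : ρ <+: a) : ∃ γ s, P.IsChainOf Γ γ s ∧ γ 0 = a ∧ γ s = ρ := by
  obtain ⟨γ, s, hc, rfl, rfl⟩ := h.exists_chain_of_root hρ hp
  exact ⟨γ, s, ⟨hc, Or.inl ⟨h, ha, Or.inl ⟨h, hρ, hp⟩⟩⟩, rfl, rfl⟩

theorem IsAttractor.exists_isChainOf {b ρ : List (Fin n)} (h : P.IsAttractor b) (hb : P.Mem Γ b)
    (hρ : ρ ∈ P.ranRoots) (hp : ρ <+: b) : ∃ γ s, P.IsChainOf Γ γ s ∧ γ s = b ∧ γ 0 = ρ := by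
  obtain ⟨γ, s, hc, rfl, rfl⟩ := (isRepeller_dual.2 h).exists_chain_of_root hρ hp
  have hc' := hc.dual
  refine ⟨_, s, ⟨hc', Or.inr (Or.inl ?_)⟩, by simp, by simp⟩
  simp only [Nat.sub_self, Nat.sub_zero]
  exact ⟨h, hb, Or.inr ⟨h, hρ, hp⟩⟩

/-- The union of the cones of all nodes on chains of `Γ`. It turns out to be the support. -/
def chainCones (P : TreePair n) (Γ : P.flowGraph.ConnectedComponent) : Set (Cantor n) :=
  {x | ∃ γ s i, P.IsChainOf Γ γ s ∧ i ≤ s ∧ x ∈ cone (γ i)}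

theorem isClosed_chainCones : IsClosed (P.chainCones Γ) := by
  have : P.chainCones Γ =
      ⋃ w ∈ {w | ∃ γ s i, P.IsChainOf Γ γ s ∧ i ≤ s ∧ w = γ i}, cone w := by
    ext x
    simp only [chainCones, Set.mem_ofPred_eq, Set.mem_iUnion]
    constructor
    · rintro ⟨γ, s, i, h, hi, hx⟩
      exact ⟨_, ⟨γ, s, i, h, hi, rfl⟩, hx⟩
    · rintro ⟨_, ⟨γ, s, i, h, hi, rfl⟩, hx⟩
      exact ⟨γ, s, i, h, hi, hx⟩
  rw [this]
  refine Set.Finite.isClosed_biUnion ((P.A.finite_leaves.union P.B.finite_leaves).subset ?_)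
    fun w _ => isClosed_cone w
  rintro _ ⟨γ, s, i, h, hi, rfl⟩
  rcases hi.lt_or_eq with hi | rfl
  · exact Or.inl (h.1.mem_A hi)
  · exact Or.inr h.1.2.2.2.1

theorem isOpen_chainCones : IsOpen (P.chainCones Γ) := by
  rw [isOpen_iff_mem_nhds]
  rintro x ⟨γ, s, i, h, hi, hx⟩
  exact Filter.mem_of_superset ((isOpen_cone _).mem_nhds hx) fun y hy => ⟨γ, s, i, h, hi, hy⟩

/-- Where a chain of `Γ` ends, other chains of `Γ` begin. -/
theorem IsChainOf.exists_mem_cone_start (hn : 0 < n) (hrev : P.IsRevealing)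
    {γ : ℕ → List (Fin n)} {s : ℕ} (h : P.IsChainOf Γ γ s) {x : Cantor n} (hx : x ∈ cone (γ s)) :
    ∃ γ' s', P.IsChainOf Γ γ' s' ∧ x ∈ cone (γ' 0) := by
  obtain ⟨hc, ⟨hr, hm, ⟨-, hρ, hp⟩ | ⟨hr', -⟩⟩ | ⟨hr, hm, hroot⟩ |
    ⟨a, b, ρ, ρ', ha, hf, hρ, hρa, hρc, hρ', hρb, hρs⟩⟩ := id h
  · by_cases hx0 : x ∈ cone (γ 0)
    · exact ⟨γ, s, h, hx0⟩
    · obtain ⟨c, hsc, hρc, hxc⟩ := exists_isSource_of_mem_cone hr hρ hp hx hx0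
      obtain ⟨b, hb⟩ := hsc.exists_isFlowLine hn hrev hr hρ hp hρc
      obtain ⟨γ', s', h', rfl⟩ := hb.exists_isChainOf hm
      exact ⟨γ', s', h', hxc⟩
  · exact absurd hr' hr.not_isAttractor
  · refine ⟨γ, s, h, cone_subset_of_prefix ?_ hx⟩
    rcases hroot with ⟨-, -, hp⟩ | ⟨-, -, hp⟩ <;> exact hp
  · obtain ⟨γ', s', h', h1, h0⟩ := hf.2.1.exists_isChainOf (hf.mem_iff.1 ha) hρ' hρb
    exact ⟨γ', s', h', cone_subset_of_prefix (h0 ▸ hρs) hx⟩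

theorem IsChainOf.exists_mem_cone_end (hn : 0 < n) (hrev : P.IsRevealing)
    {γ : ℕ → List (Fin n)} {s : ℕ} (h : P.IsChainOf Γ γ s) {x : Cantor n} (hx : x ∈ cone (γ 0)) :
    ∃ γ' s', P.IsChainOf Γ γ' s' ∧ x ∈ cone (γ' s') := by
  obtain ⟨hc, ⟨hr, hm, hroot⟩ | ⟨hr, hm, ⟨hr', -⟩ | ⟨-, hρ, hp⟩⟩ |
    ⟨a, b, ρ, ρ', ha, hf, hρ, hρa, hρc, hρ', hρb, hρs⟩⟩ := id h
  · refine ⟨γ, s, h, cone_subset_of_prefix ?_ hx⟩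
    rcases hroot with ⟨-, -, hp⟩ | ⟨-, -, hp⟩ <;> exact hp
  · exact absurd hr hr'.not_isAttractor
  · by_cases hxs : x ∈ cone (γ s)
    · exact ⟨γ, s, h, hxs⟩
    · obtain ⟨d, hd, hρd, hxd⟩ := exists_isSink_of_mem_cone hr hρ hp hx hxs
      obtain ⟨a, γ', s', h', rfl, hf⟩ := hd.exists_isFlowLine hn hrev hr hρ hp hρd
      exact ⟨γ', s', hf.isChainOf h' (hf.mem_iff.2 hm), hxd⟩
  · obtain ⟨γ', s', h', h1, h0⟩ := hf.1.exists_isChainOf ha hρ hρa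
    exact ⟨γ', s', h', cone_subset_of_prefix (h0 ▸ hρc) hx⟩

theorem apply_mem_chainCones (hn : 0 < n) (hP : P.Represents α) (hrev : P.IsRevealing)
    {x : Cantor n} (hx : x ∈ P.chainCones Γ) : (α ^ (1 : ℤ)) x ∈ P.chainCones Γ := by
  have key : ∀ γ s i, P.IsChainOf Γ γ s → i < s → x ∈ cone (γ i) →
      (α ^ (1 : ℤ)) x ∈ P.chainCones Γ := by
    rintro γ s i h hi ⟨z, rfl⟩
    refine ⟨γ, s, i + 1, h, hi, ?_⟩
    rw [zpow_one, hP.apply_of_maps (h.1.2.2.1 i hi)]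
    exact cat_mem_cone _ _
  obtain ⟨γ, s, i, h, hi, hx⟩ := hx
  rcases hi.lt_or_eq with hi | rfl
  · exact key γ s i h hi hx
  · obtain ⟨γ', s', h', hx'⟩ := h.exists_mem_cone_start hn hrev hx
    exact key γ' s' 0 h' h'.1.pos hx'

theorem inv_apply_mem_chainCones (hn : 0 < n) (hP : P.Represents α) (hrev : P.IsRevealing)
    {x : Cantor n} (hx : x ∈ P.chainCones Γ) : (α ^ (-1 : ℤ)) x ∈ P.chainCones Γ := by
  have key : ∀ γ s i, P.IsChainOf Γ γ s → i < s → x ∈ cone (γ (i + 1)) →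
      (α ^ (-1 : ℤ)) x ∈ P.chainCones Γ := by
    rintro γ s i h hi ⟨z, rfl⟩
    refine ⟨γ, s, i, h, hi.le, ?_⟩
    rw [← hP.apply_of_maps (h.1.2.2.1 i hi)]
    have : (α ^ (-1 : ℤ)) ((α ^ (1 : ℤ)) (cat (γ i) z)) = cat (γ i) z := by
      rw [← zpow_add_apply]
      rfl
    rw [zpow_one] at this
    rw [this]
    exact cat_mem_cone _ _
  obtain ⟨γ, s, i, h, hi, hx⟩ := hx
  rcases i with _ | i
  · obtain ⟨γ', s', h', hx'⟩ := h.exists_mem_cone_end hn hrev hx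
    have hs := h'.1.pos
    exact key γ' s' (s' - 1) h' (by omega) (by rwa [Nat.sub_add_cancel hs])
  · exact key γ s i h hi hx

theorem zpow_apply_mem_chainCones (hn : 0 < n) (hP : P.Represents α) (hrev : P.IsRevealing)
    {x : Cantor n} (hx : x ∈ P.chainCones Γ) (k : ℤ) : (α ^ k) x ∈ P.chainCones Γ := by
  induction k with
  | zero => exact hx
  | succ k ih =>
    rw [add_comm, zpow_add_apply]
    exact apply_mem_chainCones hn hP hrev ih
  | pred k ih =>
    rw [sub_eq_add_neg, add_comm, zpow_add_apply]
    exact inv_apply_mem_chainCones hn hP hrev ih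

theorem exists_zpow_apply_mem_cone_of_mem_chainCones (hP : P.Represents α) {x : Cantor n}
    (hx : x ∈ P.chainCones Γ) :
    ∃ (k : ℤ) (v ρ : List (Fin n)), P.Mem Γ v ∧ P.IsRoot v ρ ∧ (α ^ k) x ∈ cone ρ := by
  obtain ⟨γ, s, i, h, hi, z, rfl⟩ := hx
  obtain ⟨hc, ⟨hr, hm, hroot⟩ | ⟨hr, hm, hroot⟩ |
    ⟨a, b, ρ, ρ', ha, hf, hρ, hρa, hρc, hρ', hρb, hρs⟩⟩ := h
  · refine ⟨(s : ℤ) - i, _, _, hm, hroot, ?_⟩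
    rw [hP.zpow_apply_chain hc hi le_rfl]
    exact cat_mem_cone _ _
  · refine ⟨((0 : ℕ) : ℤ) - i, _, _, hm, hroot, ?_⟩
    rw [hP.zpow_apply_chain hc hi (Nat.zero_le s)]
    exact cat_mem_cone _ _
  · refine ⟨((0 : ℕ) : ℤ) - i, a, ρ, ha, Or.inl ⟨hf.1, hρ, hρa⟩, ?_⟩
    rw [hP.zpow_apply_chain hc hi (Nat.zero_le s)]
    exact cone_subset_of_prefix hρc (cat_mem_cone _ _)

/-- The orbits of the sources and their limit points stay in the cones of the chains; conversely,
such a cone has an iterate under the root of a component, all of which is in the support. -/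
theorem support_eq_chainCones (hn : 2 ≤ n) (hP : P.Represents α) (hrev : P.IsRevealing) :
    P.support α Γ = P.chainCones Γ := by
  apply Set.Subset.antisymm
  · refine closure_minimal (fun x hx => ?_) isClosed_chainCones
    obtain ⟨a, b, c, ha, hf, k, hk⟩ := mem_sourceOrbits_iff.1 hx
    obtain ⟨γ, s, h, rfl⟩ := hf.exists_isChainOf ha
    have := zpow_apply_mem_chainCones (by omega) hP hrev (Γ := Γ)
      ⟨γ, s, 0, h, Nat.zero_le s, hk⟩ (-k)
    rw [← zpow_add_apply, neg_add_cancel] at this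
    exact this
  · intro x hx
    obtain ⟨k, v, ρ, hv, hroot, hk⟩ := exists_zpow_apply_mem_cone_of_mem_chainCones hP hx
    have := zpow_apply_mem_support (hroot.cone_subset_support hn hP hrev hv hk) (-k)
    rw [← zpow_add_apply, neg_add_cancel] at this
    exact this

theorem isOpen_support (hn : 2 ≤ n) (hP : P.Represents α) (hrev : P.IsRevealing) :
    IsOpen (P.support α Γ) := by
  rw [support_eq_chainCones hn hP hrev]
  exact isOpen_chainCones

theorem isClosed_support : IsClosed (P.support α Γ) := isClosed_closure

theorem exists_zpow_apply_mem_cone (hn : 2 ≤ n) (hP : P.Represents α) (hrev : P.IsRevealing)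
    {x : Cantor n} (hx : x ∈ P.support α Γ) :
    ∃ (k : ℤ) (v ρ : List (Fin n)), P.Mem Γ v ∧ P.IsRoot v ρ ∧ (α ^ k) x ∈ cone ρ :=
  exists_zpow_apply_mem_cone_of_mem_chainCones hP (support_eq_chainCones hn hP hrev ▸ hx)

/-! ### Spreading of fixed points along flow lines -/

theorem IsRoot.unique {v ρ ρ' : List (Fin n)} (h : P.IsRoot v ρ) (h' : P.IsRoot v ρ') :
    ρ = ρ' := by
  rcases h with ⟨hr, hρ, hp⟩ | ⟨hr, hρ, hp⟩ <;> rcases h' with ⟨hr', hρ', hp'⟩ | ⟨hr', hρ', hp'⟩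
  · exact P.B.leaf_eq_of_prefix_of_prefix hρ.1 hρ'.1 hp hp'
  · exact absurd hr' hr.not_isAttractor
  · exact absurd hr hr'.not_isAttractor
  · exact P.A.leaf_eq_of_prefix_of_prefix hρ.1 hρ'.1 hp hp'

/-- An invariant open set that contains the periodic point under a root contains the whole cone,
which contracts to that point. -/
theorem IsRoot.cone_subset_of_periodic_mem (hn : 2 ≤ n) (hP : P.Represents α)
    (hrev : P.IsRevealing) {F : Set (Cantor n)} (hF : IsOpen F)
    (hinv : ∀ x ∈ P.support α Γ, ∀ k : ℤ, x ∈ F → (α ^ k) x ∈ F)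
    {ρ ω : List (Fin n)} (hv : P.Mem Γ (ρ ++ ω)) (h : P.IsRoot (ρ ++ ω) ρ) {q : Cantor n}
    (hq : cat ω q = q) (hqF : cat ρ q ∈ F) : cone ρ ⊆ F := by
  obtain ⟨ω', e, hω', hω, he, -⟩ := h.exists_spine hP
  obtain rfl := List.append_cancel_left hω'
  rintro _ ⟨z, rfl⟩
  obtain ⟨k, hk⟩ := ((((continuous_cat ρ).tendsto _).comp
    (tendsto_iterate_cat hω hq z)).eventually (hF.mem_nhds hqF)).exists
  have h1 : (α ^ (e * k)) (cat ρ z) ∈ F := by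
    rw [zpow_mul_apply_cat he]
    exact hk
  have h2 := hinv _ (zpow_apply_mem_support (h.cone_subset_support hn hP hrev hv
    (cat_mem_cone ρ z)) _) (-(e * k)) h1
  rw [← zpow_add_apply, neg_add_cancel] at h2
  exact h2

/-- If moreover the set contains its limit points, one point outside the spine suffices, as
the iterates of that point accumulate at the periodic point. -/
theorem IsRoot.cone_subset_of_mem (hn : 2 ≤ n) (hP : P.Represents α)
    (hrev : P.IsRevealing) {F : Set (Cantor n)} (hF : IsOpen F)
    (hinv : ∀ x ∈ P.support α Γ, ∀ k : ℤ, x ∈ F → (α ^ k) x ∈ F)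
    (hacc : ∀ p, (∃ᶠ y in nhdsWithin p {p}ᶜ, y ∈ F) → p ∈ F)
    {v ρ : List (Fin n)} (hv : P.Mem Γ v) (h : P.IsRoot v ρ) {x : Cantor n}
    (hx : x ∈ cone ρ) (hxv : x ∉ cone v) (hxF : x ∈ F) : cone ρ ⊆ F := by
  obtain ⟨ω, e, rfl, hω, he, -⟩ := h.exists_spine hP
  obtain ⟨q, hq⟩ := exists_cat_self hω
  obtain ⟨y, rfl⟩ := hx
  refine h.cone_subset_of_periodic_mem hn hP hrev hF hinv hv hq (hacc _ ?_)
  have hyq : y ≠ q := by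
    rintro rfl
    rw [cat_mem_cone_append_iff] at hxv
    exact hxv ⟨y, hq⟩
  have ht : Filter.Tendsto (fun k => cat ρ ((cat ω)^[k] y)) Filter.atTop
      (nhdsWithin (cat ρ q) {cat ρ q}ᶜ) := by
    refine tendsto_nhdsWithin_iff.2 ⟨((continuous_cat ρ).tendsto _).comp
      (tendsto_iterate_cat hω hq y), Filter.Eventually.of_forall fun k hk => hyq ?_⟩
    apply (cat_injective ω).iterate k
    rw [Function.iterate_fixed hq]
    exact cat_injective ρ hk
  refine ht.frequently (Filter.Eventually.frequently (Filter.Eventually.of_forall fun k => ?_))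
  rw [← zpow_mul_apply_cat he]
  exact hinv _ (h.cone_subset_support hn hP hrev hv (cat_mem_cone _ _)) _ hxF

/-- The cone of the source of a flow line is carried to the cone of the sink; they lie outside the
spines of the components that the flow line connects. -/
theorem IsFlowLine.cone_subset_iff (hn : 2 ≤ n) (hP : P.Represents α)
    (hrev : P.IsRevealing) {F : Set (Cantor n)} (hF : IsOpen F)
    (hinv : ∀ x ∈ P.support α Γ, ∀ k : ℤ, x ∈ F → (α ^ k) x ∈ F)
    (hacc : ∀ p, (∃ᶠ y in nhdsWithin p {p}ᶜ, y ∈ F) → p ∈ F)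
    {a b c : List (Fin n)} (ha : P.Mem Γ a) (hb : P.Mem Γ b) (h : P.IsFlowLine a b c) :
    (∀ ρ, P.IsRoot a ρ → cone ρ ⊆ F) ↔ ∀ ρ, P.IsRoot b ρ → cone ρ ⊆ F := by
  obtain ⟨hra, hab, hsc, ⟨ρ, hρ, hρa, hρc⟩, γ, s, hc, rfl, hs, ρ', hρ', hρb, hρs⟩ := h
  have hroot : P.IsRoot a ρ := Or.inl ⟨hra, hρ, hρa⟩
  have hroot' : P.IsRoot b ρ' := Or.inr ⟨hab, hρ', hρb⟩
  let z : Cantor n := fun _ => ⟨0, by omega⟩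
  have hx : cat (γ 0) z ∈ cone ρ := cone_subset_of_prefix hρc (cat_mem_cone _ _)
  have hxa : cat (γ 0) z ∉ cone a := fun hx' => by
    have := P.A.leaf_eq_of_mem_cone hsc.1 hra.mem_A (cat_mem_cone _ _) hx'
    exact hsc.2.2 (this ▸ hra)
  have hy : cat (γ s) z ∈ cone ρ' := cone_subset_of_prefix hρs (cat_mem_cone _ _)
  have hyb : cat (γ s) z ∉ cone b := fun hx' => by
    have := P.B.leaf_eq_of_mem_cone hs.1 hab.mem_B (cat_mem_cone _ _) hx'
    exact hs.2.2 (this ▸ hab)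
  have hxX := hroot.cone_subset_support hn hP hrev ha hx
  have hyX := hroot'.cone_subset_support hn hP hrev hb hy
  constructor
  · intro hC τ hτ
    refine hτ.cone_subset_of_mem hn hP hrev hF hinv hacc hb (hroot'.unique hτ ▸ hy) hyb ?_
    rw [← hP.zpow_apply_chain hc (Nat.zero_le s) le_rfl]
    exact hinv _ hxX _ (hC ρ hroot hx)
  · intro hC τ hτ
    refine hτ.cone_subset_of_mem hn hP hrev hF hinv hacc ha (hroot.unique hτ ▸ hx) hxa ?_
    rw [← hP.zpow_apply_chain hc le_rfl (Nat.zero_le s)]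
    exact hinv _ hyX _ (hC ρ' hroot' hy)

/-- An invariant open set with no outer limit points that contains one of the repelling points of
a component contains the support, as the component is connected. -/
theorem support_subset_of_repellingLabel_mem (hn : 2 ≤ n) (hP : P.Represents α)
    (hrev : P.IsRevealing) {F : Set (Cantor n)} (hF : IsOpen F)
    (hinv : ∀ x ∈ P.support α Γ, ∀ k : ℤ, x ∈ F → (α ^ k) x ∈ F)
    (hacc : ∀ p, (∃ᶠ y in nhdsWithin p {p}ᶜ, y ∈ F) → p ∈ F)
    {r : Cantor n} (hr : r ∈ P.repellingLabels Γ) (hrF : r ∈ F) : P.support α Γ ⊆ F := by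
  obtain ⟨u, hu, γ, s, ω, q, hc, h0, hω, hq, i, hi, rfl⟩ := hr
  have hrep : P.IsRepeller (γ 0) := ⟨γ, s, hc, rfl, hω ▸ ⟨ω, rfl⟩⟩
  have hroot : P.IsRoot (γ 0) (γ s) :=
    Or.inl ⟨hrep, ⟨hc.2.2.2.1, P.A.mem_of_prefix (hω ▸ ⟨ω, rfl⟩) hc.1.1, hc.2.2.2.2⟩,
      hω ▸ ⟨ω, rfl⟩⟩
  have hm : P.Mem Γ (γ 0) := ⟨u, hu, h0.symm⟩
  have hq0 : cat (γ 0) q = cat (γ s) q := by rw [hω, cat_append, hq]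
  have hqX : cat (γ 0) q ∈ P.support α Γ := by
    rw [hq0]
    exact hroot.cone_subset_support hn hP hrev hm (cat_mem_cone _ _)
  have h0F : cat (γ s) q ∈ F := by
    have h1 := hP.zpow_apply_chain hc (Nat.zero_le s) hi.le q
    rw [← hq0, ← hP.zpow_apply_chain hc hi.le (Nat.zero_le s)]
    refine hinv _ ?_ _ hrF
    rw [← h1]
    exact zpow_apply_mem_support hqX _
  have hcone : cone (γ s) ⊆ F := by
    rw [hω] at hm hroot
    exact hroot.cone_subset_of_periodic_mem hn hP hrev hF hinv hm hq h0F
  intro x hx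
  obtain ⟨k, v, ρ, hv, hvρ, hk⟩ := exists_zpow_apply_mem_cone hn hP hrev hx
  have hCv := (Mem.induction (C := fun v => ∀ ρ, P.IsRoot v ρ → cone ρ ⊆ F)
    (fun a b c ha hb h => h.cone_subset_iff hn hP hrev hF hinv hacc ha hb) hm hv (Or.inl hrep)
    (fun ρ hρ => hroot.unique hρ ▸ hcone)) ρ hvρ
  have := hinv _ (zpow_apply_mem_support hx k) (-k) (hCv hk)
  rw [← zpow_add_apply, neg_add_cancel] at this
  exact this

/-! ### The repelling periodic points -/

theorem finite_repellingLabels : (P.repellingLabels Γ).Finite := by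
  have hsub : P.repellingLabels Γ ⊆ ⋃ a ∈ P.A.leaves, {p | ∃ γ s w q, P.IsChain γ s ∧ γ 0 = a ∧
      γ 0 = γ s ++ w ∧ cat w q = q ∧ ∃ i < s, p = cat (γ i) q} := by
    rintro p ⟨u, hu, γ, s, w, q, hc, h0, hw, hq, hi⟩
    simp only [Set.mem_iUnion]
    exact ⟨γ 0, hc.1, γ, s, w, q, hc, rfl, hw, hq, hi⟩
  refine Set.Finite.subset (P.A.finite_leaves.biUnion fun a _ => ?_) hsub
  rcases Set.eq_empty_or_nonempty {p : Cantor n | ∃ γ s w q, P.IsChain γ s ∧ γ 0 = a ∧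
      γ 0 = γ s ++ w ∧ cat w q = q ∧ ∃ i < s, p = cat (γ i) q} with h | h
  · rw [h]
    exact Set.finite_empty
  obtain ⟨_, γ, s, w, q, hc, h0, hw, hq, -⟩ := h
  refine ((Set.finite_Iio s).image fun i => cat (γ i) q).subset ?_
  rintro _ ⟨γ', s', w', q', hc', h0', hw', hq', i, hi, rfl⟩
  obtain ⟨rfl, heq⟩ := hc.eq_of_start hc' (h0.trans h0'.symm)
  have hww : w = w' := by
    rw [← heq 0 (Nat.zero_le _), ← heq s le_rfl, hw] at hw'
    exact List.append_cancel_left hw'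
  subst hww
  have hne : w ≠ [] := by
    rintro rfl
    rw [List.append_nil] at hw
    exact hc.2.2.2.2 (hw ▸ hc.1)
  refine ⟨i, hi, ?_⟩
  simp only
  rw [heq i hi.le, eq_of_cat_self hne hq hq']

theorem nonempty_repellingLabels (hn : 2 ≤ n) (hP : P.Represents α) (hrev : P.IsRevealing)
    (hΓ : P.IsNonTorsion Γ) : (P.repellingLabels Γ).Nonempty := by
  have hrep : ∃ a, P.IsRepeller a ∧ P.Mem Γ a := by
    obtain ⟨u, hu, h | h⟩ := hΓ
    · exact ⟨u.1, h, u, hu, rfl⟩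
    · obtain ⟨ρ, hρ⟩ := exists_isRoot (Or.inr h)
      obtain ⟨ω, e, hω, hne, -⟩ := hρ.exists_spine hP
      obtain ⟨y, hy⟩ := exists_notMem_cone hn hne
      obtain ⟨a, b, c, ha, hf, -⟩ := mem_sourceOrbits_iff.1 (hρ.mem_sourceOrbits (by omega) hP hrev
        ⟨u, hu, rfl⟩ (cat_mem_cone ρ y) (by rwa [hω, cat_mem_cone_append_iff]))
      exact ⟨a, hf.1, ha⟩
  obtain ⟨a, ha, u, hu, rfl⟩ := hrep
  obtain ⟨γ, s, hc, h0, ⟨ω, hω⟩, hr⟩ := ha.exists_root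
  have hne : ω ≠ [] := by
    rintro rfl
    rw [List.append_nil] at hω
    exact hr.2.2 (hω ▸ ha.mem_A)
  obtain ⟨q, hq⟩ := exists_cat_self (n := n) hne
  exact ⟨_, u, hu, γ, s, ω, q, hc, h0, h0.trans hω.symm, hq, 0, hc.pos, rfl⟩

/-- The word `ω` is removed by the power that goes once along the chain of the repeller. -/
theorem exists_pow_of_mem_repellingLabels (hn : 2 ≤ n) (hP : P.Represents α)
    (hrev : P.IsRevealing) {p : Cantor n} (hp : p ∈ P.repellingLabels Γ) :
    p ∈ P.support α Γ ∧
      ∃ s : ℕ, 0 < s ∧ (α ^ s) p = p ∧ ∃ d, 0 < d ∧ HasExponentAt (α ^ s) p d := by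
  obtain ⟨u, hu, γ, s, ω, q, hc, h0, hω, hq, i, hi, rfl⟩ := hp
  have hpre : γ s <+: γ 0 := ⟨ω, hω.symm⟩
  have hrep : P.IsRepeller (γ 0) := ⟨γ, s, hc, rfl, hpre⟩
  have hroot : P.IsRoot (γ 0) (γ s) :=
    Or.inl ⟨hrep, ⟨hc.2.2.2.1, P.A.mem_of_prefix hpre hc.1.1, hc.2.2.2.2⟩, hpre⟩
  have hne : ω ≠ [] := by
    rintro rfl
    rw [List.append_nil] at hω
    exact hc.2.2.2.2 (hω ▸ hc.1)
  have hstep : ∀ z, (α ^ s) (cat (γ i ++ ω) z) = cat (γ i) z := by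
    intro z
    have h1 := hP.zpow_apply_chain hc hi.le le_rfl (cat ω z)
    rw [← cat_append (γ s), ← hω] at h1
    have h2 := hP.zpow_apply_chain hc (Nat.zero_le s) hi.le z
    rw [← h1, ← zpow_add_apply] at h2
    rw [cat_append, ← h2]
    rw [show ((i : ℤ) - ((0 : ℕ) : ℤ) + (s - i)) = s by push_cast; ring, zpow_natCast]
  have hpq : cat (γ i ++ ω) q = cat (γ i) q := by rw [cat_append, hq]
  refine ⟨?_, s, hc.pos, ?_, ω.length, by exact_mod_cast List.length_pos_of_ne_nil hne,
    γ i ++ ω, γ i, ⟨q, hpq⟩, hstep, by simp⟩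
  · have h2 := hP.zpow_apply_chain hc (Nat.zero_le s) hi.le q
    rw [← h2]
    exact zpow_apply_mem_support (hroot.cone_subset_support hn hP hrev ⟨u, hu, h0.symm⟩
      (cone_subset_of_prefix hpre (cat_mem_cone _ _))) _
  · conv_lhs => rw [← hpq]
    exact hstep q

/-- A periodic point of the support has an iterate under the root of the component of a vertex,
where the only periodic point is the end of the spine. A positive exponent excludes that the vertex
is an attractor. -/
theorem mem_repellingLabels_of_pow (hn : 2 ≤ n) (hα : α ∈ V n) (hP : P.Represents α)
    (hrev : P.IsRevealing) {x : Cantor n} (hx : x ∈ P.support α Γ) {k : ℕ} (hk : 0 < k)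
    (hfix : (α ^ k) x = x) (hexp : 0 < exponent (α ^ k) x) : x ∈ P.repellingLabels Γ := by
  obtain ⟨j, v, ρ, hv, hroot, z, hz⟩ := exists_zpow_apply_mem_cone hn hP hrev hx
  obtain ⟨ω, e, rfl, hω, he, hsign⟩ := hroot.exists_spine hP
  obtain ⟨q, hq⟩ := exists_cat_self hω
  obtain ⟨hfix', hexp'⟩ := exponent_apply_of_commute hn (pow_mem hα k) (zpow_mem hα j)
    ((Commute.refl α).pow_left k |>.zpow_right j) hfix
  rw [← hexp', ← hz] at hexp
  rw [← hz] at hfix'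
  obtain rfl : z = q := by
    refine eq_of_iterate_cat_eq hω hk hq (cat_injective ρ ?_)
    rw [← zpow_mul_apply_cat he, mul_comm, zpow_mul, zpow_natCast, zpow_apply_of_fixed hfix']
  rcases hsign with ⟨hrep, -⟩ | ⟨-, hpos⟩
  · obtain ⟨u, hu, hu1⟩ := hv
    have hρ : ρ ∈ P.domRoots := by
      rcases hroot with ⟨-, h, -⟩ | ⟨h, -⟩
      · exact h
      · exact absurd h hrep.not_isAttractor
    obtain ⟨γ, s, hc, h0, rfl⟩ := hrep.exists_chain_of_root hρ ⟨ω, rfl⟩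
    -- `α ^ s` fixes the end of the spine, so `x = α ^ (-j) y` only depends on `-j` modulo `s`
    have hs : (0 : ℤ) < s := by exact_mod_cast hc.pos
    have hy : cat (γ s) z = cat (γ 0) z := by rw [h0, cat_append, hq]
    have hsy : (α ^ (s : ℤ)) (cat (γ s) z) = cat (γ s) z := by
      conv_lhs => rw [hy, zpow_natCast, hP.pow_apply_start hc z s le_rfl]
    obtain ⟨i, hi⟩ := Int.eq_ofNat_of_zero_le (Int.emod_nonneg (-j) hs.ne')
    have his : i < s := by
      have := Int.emod_lt_of_pos (-j) hs
      omega
    refine ⟨u, hu, γ, s, ω, z, hc, by rw [h0, hu1], h0, hq, i, his, ?_⟩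
    have h1 : x = (α ^ (-j)) (cat (γ s) z) := by
      rw [hz, ← zpow_add_apply, neg_add_cancel]
      rfl
    rw [h1, ← Int.emod_add_mul_ediv (-j) s, zpow_add_apply, zpow_mul, zpow_apply_of_fixed hsy, hi,
      hy]
    exact hP.pow_apply_start hc z i his.le
  · exfalso
    -- at an attractor `α ^ m` has a negative exponent but `α ^ k` a positive one, a contradiction
    -- in `α ^ (m * k)`
    obtain ⟨m, rfl⟩ := Int.eq_ofNat_of_zero_le hpos.le
    have hm : (α ^ m) (cat ρ z) = cat ρ z := by
      have := he z
      rw [hq] at this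
      exact this
    have hme : exponent (α ^ m) (cat ρ z) = -(ω.length : ℤ) :=
      HasExponentAt.exponent_eq hn ⟨ρ, ρ ++ ω, ⟨z, rfl⟩,
        fun y => by rw [cat_append]; exact he y, by simp⟩
    have h1 := (exponent_pow hn (pow_mem hα m) hm k).2
    have h2 := (exponent_pow hn (pow_mem hα k) hfix' m).2
    rw [← pow_mul, mul_comm, pow_mul, h2, hme] at h1
    have h3 : 0 < (m : ℤ) * exponent (α ^ k) (cat ρ z) := mul_pos hpos hexp
    have h4 : 0 ≤ (k : ℤ) * ω.length := by positivity
    linarith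

end TreePair

/-! ### Groups with a faithful integral cocycle -/

/-- A group with a nontrivial homomorphism to `ℤ` is a semidirect product of the kernel and `ℤ`,
as the image is infinite cyclic. -/
theorem exists_mulEquiv_ker_semidirectProduct {G : Type*} [Group G] (S : G →* Multiplicative ℤ)
    {a : G} (ha : S a ≠ 1) :
    ∃ φ : Multiplicative ℤ →* MulAut S.ker, Nonempty (G ≃* S.ker ⋊[φ] Multiplicative ℤ) := by
  obtain ⟨⟨_, t, rfl⟩, ht⟩ := (inferInstance : IsCyclic S.range).exists_generator
  have ht' : ∀ g, ∃ k : ℤ, S t ^ k = S g := fun g => by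
    obtain ⟨k, hk⟩ := Subgroup.mem_zpowers_iff.1 (ht ⟨S g, g, rfl⟩)
    exact ⟨k, congrArg Subtype.val hk⟩
  have ht1 : S t ≠ 1 := fun h => by
    obtain ⟨k, hk⟩ := ht' a
    rw [h, one_zpow] at hk
    exact ha hk.symm
  let f : Multiplicative ℤ →* G := zpowersHom G t
  have hf : ∀ k, f k = t ^ k.toAdd := fun _ => rfl
  let φ : Multiplicative ℤ →* MulAut S.ker := MulAut.conjNormal.comp f
  let Ψ : S.ker ⋊[φ] Multiplicative ℤ →* G :=
    SemidirectProduct.lift S.ker.subtype f (fun k => by ext x; simp [φ])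
  have hΨ : ∀ x, Ψ x = x.left * t ^ x.right.toAdd := fun x => by
    simp [Ψ, SemidirectProduct.lift, hf]
  refine ⟨φ, ⟨(MulEquiv.ofBijective Ψ ⟨?_, ?_⟩).symm⟩⟩
  · rw [injective_iff_map_eq_one]
    intro x hx
    rw [hΨ] at hx
    have h1 : S t ^ x.right.toAdd = 1 := by
      have := congrArg S hx
      rwa [map_mul, x.left.2, one_mul, map_zpow, map_one] at this
    have h2 : x.right.toAdd = 0 := by
      have h3 : x.right.toAdd * (S t).toAdd = 0 := by
        have := congrArg Multiplicative.toAdd h1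
        simpa using this
      exact (mul_eq_zero.1 h3).resolve_right fun h => ht1 (Multiplicative.toAdd.injective h)
    rw [h2, zpow_zero, mul_one] at hx
    exact SemidirectProduct.ext (Subtype.ext hx) (Multiplicative.toAdd.injective h2)
  · intro g
    obtain ⟨k, hk⟩ := ht' g
    refine ⟨⟨⟨g * t ^ (-k), ?_⟩, Multiplicative.ofAdd k⟩, ?_⟩
    · rw [MonoidHom.mem_ker, map_mul, map_zpow, zpow_neg, hk, mul_inv_cancel]
    · rw [hΨ]
      simp

/-- Let `G` act on a finite set `R` with a cocycle `ℓ` in `ℤ`, such that an element is trivial if it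
fixes some point of `R` and the cocycle vanishes there. Suppose that some `b` fixes all of `R` and
has positive cocycle on `R`. Summing the cocycle over `R` gives a homomorphism. An element `g` of
its kernel that fixes a point `r` is trivial, as `b` and `g` have commensurable values of the
cocycle at `r`; so the kernel embeds in `R` by `g ↦ g r`, which makes it finite. -/
theorem exists_hom_of_cocycle {G Ω : Type*} [Group G] (ρ : G →* Equiv.Perm Ω) (R : Finset Ω)
    (hne : R.Nonempty) (hR : ∀ g, ∀ r ∈ R, ρ g r ∈ R) (ℓ : G → Ω → ℤ)
    (hℓ : ∀ g h r, ℓ (g * h) r = ℓ g (ρ h r) + ℓ h r)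
    (hfaith : ∀ g, ∀ r ∈ R, ρ g r = r → ℓ g r = 0 → g = 1)
    (b : G) (hb : ∀ r ∈ R, ρ b r = r ∧ 0 < ℓ b r) :
    ∃ S : G →* Multiplicative ℤ, (∀ g, (S g).toAdd = ∑ r ∈ R, ℓ g r) ∧ Finite S.ker ∧
      (∀ g, g ∈ S.ker ↔ IsOfFinOrder g) ∧
      ∃ φ : Multiplicative ℤ →* MulAut S.ker, Nonempty (G ≃* S.ker ⋊[φ] Multiplicative ℤ) := by
  have hR' : ∀ g r, r ∈ R ↔ ρ g r ∈ R := fun g r => ⟨hR g r, fun h => by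
    simpa using hR g⁻¹ _ h⟩
  let S : G →* Multiplicative ℤ := MonoidHom.mk' (fun g => Multiplicative.ofAdd (∑ r ∈ R, ℓ g r))
    fun g h => by
      rw [← ofAdd_add]
      congr 1
      rw [← Finset.sum_equiv (ρ h) (fun r => hR' h r) (g := ℓ g) (fun r _ => rfl),
        ← Finset.sum_add_distrib]
      exact Finset.sum_congr rfl fun r _ => hℓ g h r
  have hS : ∀ g, (S g).toAdd = ∑ r ∈ R, ℓ g r := fun _ => rfl
  have hSb : 0 < (S b).toAdd := Finset.sum_pos (fun r hr => (hb r hr).2) hne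
  have hpow : ∀ g r, ρ g r = r → ∀ k : ℕ, ρ (g ^ k) r = r ∧ ℓ (g ^ k) r = k * ℓ g r := by
    intro g r hg k
    induction k with
    | zero =>
      have := hℓ 1 1 r
      simp at this
      simp [this]
    | succ k ih =>
      constructor
      · rw [pow_succ, map_mul, Equiv.Perm.mul_apply, hg, ih.1]
      · rw [pow_succ, hℓ, hg, ih.2]
        push_cast
        ring
  have hzpow : ∀ g r, ρ g r = r → ∀ k : ℤ, ρ (g ^ k) r = r ∧ ℓ (g ^ k) r = k * ℓ g r := by
    intro g r hg k
    obtain ⟨k, rfl | rfl⟩ := k.eq_nat_or_neg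
    · simpa using hpow g r hg k
    · obtain ⟨h1, h2⟩ := hpow g r hg k
      have h3 : ρ (g ^ (-(k : ℤ))) r = r := by
        rw [zpow_neg, zpow_natCast, map_inv, Equiv.Perm.inv_eq_iff_eq, h1]
      refine ⟨h3, ?_⟩
      have h4 := hℓ (g ^ k) (g ^ (-(k : ℤ))) r
      have h5 := (hpow g r hg 0).2
      rw [h3, h2] at h4
      rw [zpow_neg, zpow_natCast, mul_inv_cancel] at h4
      rw [zpow_neg, zpow_natCast]
      simp at h5
      rw [h5] at h4
      linarith
  obtain ⟨r, hr⟩ := hne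
  have hker : ∀ g, g ∈ S.ker → ρ g r = r → g = 1 := by
    intro g hg hgr
    obtain ⟨hbr, hbp⟩ := hb r hr
    -- the exponents are chosen such that the cocycle vanishes at `r`
    have h1 : g ^ ℓ b r * b ^ (-ℓ g r) = 1 := by
      apply hfaith _ r hr
      · rw [map_mul, Equiv.Perm.mul_apply, (hzpow b r hbr _).1, (hzpow g r hgr _).1]
      · rw [hℓ, (hzpow b r hbr _).1, (hzpow g r hgr _).2, (hzpow b r hbr _).2]
        ring
    have h2 : ℓ g r = 0 := by
      have := congrArg (fun x => (S x).toAdd) h1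
      rw [MonoidHom.mem_ker] at hg
      simp [hg] at this
      rcases this with h | h
      · exact h
      · rw [h] at hSb
        exact absurd hSb (lt_irrefl _)
    exact hfaith g r hr hgr h2
  have hfin : Finite S.ker := by
    refine Finite.of_injective (fun g : S.ker => (⟨ρ g r, hR _ _ hr⟩ : R)) fun g h hgh => ?_
    have h1 : ρ (g : G) r = ρ (h : G) r := congrArg Subtype.val hgh
    have h2 := hker (h⁻¹ * g : S.ker) (h⁻¹ * g).2 (by simp [h1])
    exact (inv_mul_eq_one.1 (Subtype.ext h2)).symm
  refine ⟨S, hS, hfin, fun g => ⟨fun hg => ?_, fun hg => ?_⟩,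
    exists_mulEquiv_ker_semidirectProduct S (a := b) fun h => ?_⟩
  · exact S.ker.subtype.isOfFinOrder (isOfFinOrder_of_finite (⟨g, hg⟩ : S.ker))
  · rw [MonoidHom.mem_ker]
    have h1 := S.isOfFinOrder hg
    rw [isOfFinOrder_iff_pow_eq_one] at h1
    obtain ⟨k, hk, h⟩ := h1
    have h2 := congrArg Multiplicative.toAdd h
    simp at h2
    rcases h2 with h2 | h2
    · omega
    · exact h2
  · rw [h] at hSb
    exact absurd hSb (lt_irrefl _)

/-! ### Restricting a homeomorphism to an invariant clopen set -/

section Restriction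

variable {n : ℕ}

/-- The homeomorphism that is `α` on an invariant clopen set and the identity elsewhere. -/
theorem exists_restriction {α : Cantor n ≃ₜ Cantor n} (hα : α ∈ V n) {X : Set (Cantor n)}
    (hX : IsClopen X) (h1 : ∀ x ∈ X, α x ∈ X) (h2 : ∀ x ∈ X, α.symm x ∈ X) :
    ∃ β ∈ restrictedTo (V n) X, ∀ x ∈ X, β x = α x := by
  classical
  have hcont : ∀ f : Cantor n → Cantor n, Continuous f →
      Continuous fun x => if x ∈ X then f x else x := fun f hf =>
    Continuous.if (fun x hx => by
      have : frontier {x | x ∈ X} = ∅ := hX.frontier_eq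
      rw [this] at hx
      exact hx.elim) hf continuous_id
  let β : Cantor n ≃ₜ Cantor n :=
    { toFun := fun x => if x ∈ X then α x else x
      invFun := fun x => if x ∈ X then α.symm x else x
      left_inv := fun x => by
        by_cases hx : x ∈ X
        · simp [hx, h1 x hx]
        · simp [hx]
      right_inv := fun x => by
        by_cases hx : x ∈ X
        · simp [hx, h2 x hx]
        · simp [hx]
      continuous_toFun := hcont α α.continuous
      continuous_invFun := hcont α.symm α.symm.continuous }
  have hin : ∀ x ∈ X, β x = α x := fun x hx => if_pos hx
  have hout : ∀ x, x ∉ X → β x = x := fun x hx => if_neg hx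
  refine ⟨β, ⟨IsLocal.exists_treePair fun x => ?_, hout⟩, hin⟩
  have : ∃ d, HasExponentAt β x d := by
    by_cases hx : x ∈ X
    · obtain ⟨d, hd⟩ := (isLocal_of_mem hα).exists_hasExponentAt x
      exact ⟨d, hd.congr (hX.isOpen.mem_nhds hx) hin⟩
    · exact ⟨0, (hasExponentAt_one x).congr (hX.compl.isOpen.mem_nhds hx) hout⟩
  obtain ⟨d, u, v, hu, huv, -⟩ := this
  exact ⟨u, v, hu, huv⟩

theorem zpow_apply_eq_of_restriction {α β : Cantor n ≃ₜ Cantor n} {X : Set (Cantor n)}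
    (hX : ∀ x ∈ X, ∀ k : ℤ, (α ^ k) x ∈ X) (hβ : ∀ x ∈ X, β x = α x) {x : Cantor n} (hx : x ∈ X)
    (k : ℤ) : (β ^ k) x = (α ^ k) x := by
  induction k with
  | zero => rfl
  | succ k ih =>
    rw [add_comm, TreePair.zpow_add_apply, TreePair.zpow_add_apply, ih, zpow_one, zpow_one]
    exact hβ _ (hX x hx _)
  | pred k ih =>
    rw [sub_eq_add_neg, add_comm, TreePair.zpow_add_apply, TreePair.zpow_add_apply, ih, zpow_neg,
      zpow_one]
    change β.symm _ = _
    have h := hX _ (hX x hx (-(k : ℤ))) (-1)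
    rw [Homeomorph.symm_apply_eq, hβ _ h, zpow_neg_one]
    exact (α.apply_symm_apply _).symm

theorem pow_apply_eq_of_notMem {β : Cantor n ≃ₜ Cantor n} {X : Set (Cantor n)}
    (hβ : ∀ x, x ∉ X → β x = x) {x : Cantor n} (hx : x ∉ X) (k : ℕ) : (β ^ k) x = x := by
  have := zpow_apply_of_fixed (hβ x hx) k
  rwa [zpow_natCast] at this

end Restriction

/-! ### Commuting elements -/

section Commuting

variable {n : ℕ}

theorem mem_repellingPoints_of_commute (hn : 2 ≤ n) {β g : Cantor n ≃ₜ Cantor n} (hβ : β ∈ V n)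
    (hg : g ∈ V n) (hc : Commute β g) {r : Cantor n} (hr : r ∈ repellingPoints β) :
    g r ∈ repellingPoints β := by
  obtain ⟨k, hk, hfix, hs⟩ := hr
  rw [one_lt_slope_iff hn (isLocal_of_mem (pow_mem hβ k))] at hs
  obtain ⟨h1, h2⟩ := exponent_apply_of_commute hn (pow_mem hβ k) hg (hc.pow_left k) hfix
  refine ⟨k, hk, h1, ?_⟩
  rwa [one_lt_slope_iff hn (isLocal_of_mem (pow_mem hβ k)), h2]

/-- Finitely many repelling periodic points are fixed by a common power. -/
theorem exists_pow_repelling (hn : 2 ≤ n) {β : Cantor n ≃ₜ Cantor n} (hβ : β ∈ V n)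
    (hfin : (repellingPoints β).Finite) : ∃ K : ℕ, ∀ r ∈ repellingPoints β,
      (β ^ K) r = r ∧ 0 < exponent (β ^ K) r := by
  choose! k hk hfix hs using fun r (hr : r ∈ repellingPoints β) => hr
  refine ⟨∏ r ∈ hfin.toFinset, k r, fun r hr => ?_⟩
  obtain ⟨m, hm⟩ := Finset.dvd_prod_of_mem k (hfin.mem_toFinset.2 hr)
  have hpos : 0 < ∏ r ∈ hfin.toFinset, k r :=
    Finset.prod_pos fun r hr => hk r (hfin.mem_toFinset.1 hr)
  have hm0 : 0 < m := by
    rcases Nat.eq_zero_or_pos m with rfl | h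
    · omega
    · exact h
  rw [hm, pow_mul]
  obtain ⟨h1, h2⟩ := exponent_pow hn (pow_mem hβ (k r)) (hfix r hr) m
  refine ⟨h1, ?_⟩
  rw [h2]
  have := (one_lt_slope_iff hn (isLocal_of_mem (pow_mem hβ (k r))) r).1 (hs r hr)
  positivity

/-- The interior of the set of fixed points is preserved by every homeomorphism that commutes. -/
theorem apply_mem_interior_fixed {g h : Cantor n ≃ₜ Cantor n} (hgh : Commute g h) {x : Cantor n}
    (hx : x ∈ interior {y | g y = y}) : h x ∈ interior {y | g y = y} := by
  have : h ⁻¹' {y | g y = y} = {y | g y = y} := by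
    ext y
    have h1 : g (h y) = h (g y) := DFunLike.congr_fun hgh.eq y
    simp only [Set.mem_preimage, Set.mem_ofPred_eq, h1, h.injective.eq_iff]
  rw [← this, ← h.preimage_interior] at hx
  exact hx

end Commuting

end Thompson

theorem mainTheorem4 (n : ℕ) (hn : 2 ≤ n) (α : Cantor n ≃ₜ Cantor n) (hα : α ∈ V n)
    (P : TreePair n) (hP : P.Represents α) (hrev : P.IsRevealing)
    (Γ : P.flowGraph.ConnectedComponent) (hΓ : P.IsNonTorsion Γ) :
    ∃ αΓ : restrictedTo (V n) (P.support α Γ),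
      (∀ x ∈ P.support α Γ, (αΓ : Cantor n ≃ₜ Cantor n) x = α x) ∧
      (repellingPoints (αΓ : Cantor n ≃ₜ Cantor n)).Finite ∧
      repellingPoints (αΓ : Cantor n ≃ₜ Cantor n) = P.repellingLabels Γ ∧
      ∃ S : Subgroup.centralizer {αΓ} →* Multiplicative ℤ,
        (∀ g : Subgroup.centralizer {αΓ}, ((S g).toAdd : ℝ) =
          logSlopeProduct (repellingPoints (αΓ : Cantor n ≃ₜ Cantor n))
            ((g : restrictedTo (V n) (P.support α Γ)) : Cantor n ≃ₜ Cantor n)) ∧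
        Finite S.ker ∧
        (∀ g : Subgroup.centralizer {αΓ}, g ∈ S.ker ↔ IsOfFinOrder g) ∧
        ∃ φ : Multiplicative ℤ →* MulAut S.ker,
          Nonempty (Subgroup.centralizer {αΓ} ≃* S.ker ⋊[φ] Multiplicative ℤ) := by
  have hopen := TreePair.isOpen_support (Γ := Γ) hn hP hrev
  have hinv : ∀ x ∈ P.support α Γ, ∀ k : ℤ, (α ^ k) x ∈ P.support α Γ :=
    fun x hx k => TreePair.zpow_apply_mem_support hx k
  obtain ⟨β, hβX, hβα⟩ := exists_restriction hα ⟨TreePair.isClosed_support, hopen⟩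
    (fun x hx => by simpa using hinv x hx 1)
    (fun x hx => by
      have := hinv x hx (-1)
      rw [zpow_neg_one] at this
      exact this)
  have hβ : β ∈ V n := hβX.1
  have hβpow : ∀ x ∈ P.support α Γ, ∀ k : ℕ, (β ^ k) x = (α ^ k) x := fun x hx k => by
    simpa using zpow_apply_eq_of_restriction hinv hβα hx k
  have hexp : ∀ x ∈ P.support α Γ, ∀ k : ℕ, exponent (β ^ k) x = exponent (α ^ k) x :=
    fun x hx k => (((isLocal_of_mem (pow_mem hα k)).hasExponentAt hn x).congr (hopen.mem_nhds hx)
      fun y hy => hβpow y hy k).exponent_eq hn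
  have hR : repellingPoints β = P.repellingLabels Γ := by
    ext r
    constructor
    · rintro ⟨k, hk, hfix, hs⟩
      rw [one_lt_slope_iff hn (isLocal_of_mem (pow_mem hβ k))] at hs
      by_cases hr : r ∈ P.support α Γ
      · rw [hβpow r hr] at hfix
        rw [hexp r hr] at hs
        exact TreePair.mem_repellingLabels_of_pow hn hα hP hrev hr hk hfix hs
      · rw [((hasExponentAt_one r).congr
          (TreePair.isClosed_support.isOpen_compl.mem_nhds hr)
          fun y hy => pow_apply_eq_of_notMem hβX.2 hy k).exponent_eq hn] at hs
        exact absurd hs (lt_irrefl _)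
    · intro hr
      obtain ⟨hrX, s, hs, hfix, d, hd, hd'⟩ :=
        TreePair.exists_pow_of_mem_repellingLabels hn hP hrev hr
      refine ⟨s, hs, by rw [hβpow r hrX, hfix], ?_⟩
      rw [one_lt_slope_iff hn (isLocal_of_mem (pow_mem hβ s)), hexp r hrX, hd'.exponent_eq hn]
      exact hd
  have hfin : (repellingPoints β).Finite := hR ▸ TreePair.finite_repellingLabels
  let αΓ : restrictedTo (V n) (P.support α Γ) := ⟨β, hβX⟩
  have hcomm : ∀ g : Subgroup.centralizer {αΓ},
      Commute β ((g : restrictedTo (V n) (P.support α Γ)) : Cantor n ≃ₜ Cantor n) := fun g =>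
    (congrArg Subtype.val (Subgroup.mem_centralizer_singleton_iff.1 g.2)).symm
  let act : Subgroup.centralizer {αΓ} →* Equiv.Perm (Cantor n) := MonoidHom.mk'
    (fun g => ((g : restrictedTo (V n) (P.support α Γ)) : Cantor n ≃ₜ Cantor n).toEquiv)
    fun _ _ => rfl
  obtain ⟨K, hK⟩ := exists_pow_repelling hn hβ hfin
  obtain ⟨S, hS, hker, htor, hsplit⟩ := exists_hom_of_cocycle act hfin.toFinset
    (by
      rw [Set.Finite.toFinset_nonempty, hR]
      exact TreePair.nonempty_repellingLabels hn hP hrev hΓ)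
    (fun g r hr => by
      rw [Set.Finite.mem_toFinset] at hr ⊢
      exact mem_repellingPoints_of_commute hn hβ g.1.2.1 (hcomm g) hr)
    (fun g r => exponent ((g : restrictedTo (V n) (P.support α Γ)) : Cantor n ≃ₜ Cantor n) r)
    (fun g h r => exponent_mul hn (isLocal_of_mem g.1.2.1) (isLocal_of_mem h.1.2.1) r)
    (fun g r hr hgr hg0 => by
      rw [Set.Finite.mem_toFinset, hR] at hr
      have hloc := isLocal_of_mem g.1.2.1
      have hrF : r ∈ interior {y | (g.1 : Cantor n ≃ₜ Cantor n) y = y} :=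
        mem_interior_iff_mem_nhds.2 ((hg0 ▸ hloc.hasExponentAt hn r).fixed_nhds hgr)
      have hF : interior {y | (g.1 : Cantor n ≃ₜ Cantor n) y = y} ⊆ {y | _} := interior_subset
      have hsub := TreePair.support_subset_of_repellingLabel_mem hn hP hrev isOpen_interior
        (fun x hx k hxF => by
          rw [← zpow_apply_eq_of_restriction hinv hβα hx]
          exact apply_mem_interior_fixed ((hcomm g).symm.zpow_right k) hxF)
        (fun p hp => mem_interior_iff_mem_nhds.2
          (hloc.fixed_nhds_of_frequently (hp.mono fun y hy => hF hy))) hr hrF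
      refine Subtype.ext (Subtype.ext (Homeomorph.ext fun x => ?_))
      by_cases hx : x ∈ P.support α Γ
      · have := hF (hsub hx)
        exact this
      · exact g.1.2.2 x hx)
    (⟨αΓ, Subgroup.mem_centralizer_singleton_iff.2 rfl⟩ ^ K)
    (fun r hr => hK r (hfin.mem_toFinset.1 hr))
  refine ⟨αΓ, hβα, hfin, hR, S, fun g => ?_, hker, htor, hsplit⟩
  rw [hS, logSlopeProduct_eq_sum hn (isLocal_of_mem g.1.2.1) hfin]
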